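/- Let $n,m\ge 1$ be integers, let $\mathbb F_n^+$ be the free unital semigroup on generators $g_1,\dots,g_n$ with identity $g_0$ and length $|\cdot|$, and write $X_\alpha=X_{i_1}\cdots X_{i_k}$ for $\alpha=g_{i_1}\cdots g_{i_k}$, $X_{g_0}=I$. Let $f=\sum_{|\alpha|\ge1}a_\alpha X_\alpha$ be a positive regular free holomorphic function, i.e. $a_\alpha\ge 0$, $a_{g_0}=0$, $a_{g_i}>0$ for $i=1,\dots,n$, and $\limsup_k(\sum_{|\alpha|=k}|a_\alpha|^2)^{1/2k}<\infty$. For $X\in B(\mathcal H)^n$ put $\Phi_{f,X}(Y)=\sum_{k\ge1}\sum_{|\alpha|=k}a_\alpha X_\alpha YX_\alpha^*$ (weak operator topology), and let $\mathbf D_f^m(\mathcal H)$ be the set of all $X\in B(\mathcal H)^n$ for which $\Phi_{f,X}(I)$ converges and $(id-\Phi_{f,X})^s(I)\ge0$ for $s=1,\dots,m$. Put $b_{g_0}=1$ and $$b_\alpha=\sum_{j=1}^{|\alpha|}\ \sum_{\gamma_1\cdots\gamma_j=\alpha,\ |\gamma_i|\ge1}a_{\gamma_1}\cdots a_{\gamma_j}\binom{j+m-1}{m-1}\qquad(|\alpha|\ge1),$$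 and let $W_i$ be the bounded operators on the full Fock space $F^2(H_n)$ (with orthonormal basis $\{e_\alpha\}$, $e_{g_0}=1$) with $W_ie_\alpha=\sqrt{b_\alpha/b_{g_i\alpha}}\;e_{g_i\alpha}$. Assume that $\mathbf D_f^m$ is radial: there is $\delta\in(0,1)$ with $(rW_1,\dots,rW_n)\in\mathbf D_f^m(F^2(H_n))$ for all $r\in(\delta,1]$. Let $\mathcal P$ be a set of homogeneous noncommutative polynomials in $n$ indeterminates, $\mathcal M_{\mathcal P}=\overline{\rm span}\{W_\alpha p(W_1,\dots,W_n)W_\beta(1):p\in\mathcal P,\ \alpha,\beta\in\mathbb F_n^+\}$, and assume $\mathcal N_{\mathcal P}=F^2(H_n)\ominus\mathcal M_{\mathcal P}\ne\{0\}$. Let $B_i=P_{\mathcal N_{\mathcal P}}W_i|_{\mathcal N_{\mathcal P}}$ and $\mathcal S_{f,\mathcal P}=\overline{\rm span}\{B_\alpha B_\beta^*:\alpha,\beta\in\mathbb F_n^+\}$ (norm closure). Let $\mathcal H$ be a complex Hilbert space and let $A=(A_1,\dots,A_n)\in B(\mathcal H)^n$ be such that $\sum_{|\alpha|\ge1}a_\alpha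 A_\alpha A_\alpha^*$ is SOT-convergent and $p(A_1,\dots,A_n)=0$ for all $p\in\mathcal P$. Let $C(f,A)^+$ be the set of all positive $D\in B(\mathcal H)$ with $(id-\Phi_{f,A})^s(D)\ge0$ for $s=1,\dots,m$, and let $C_{rad}(f,A)^+$ be the set of all $D\in C(f,A)^+$ for which there is $\delta\in(0,1)$ such that $D\in C(f,rA)^+$ for all $r\in(\delta,1]$. Let $CP(A,\mathcal V^m_{f,\mathcal P})$ be the set of all completely positive linear maps $\varphi:\mathcal S_{f,\mathcal P}\to B(\mathcal H)$ with $\varphi(B_\alpha B_\beta^*)=A_\alpha\varphi(I)A_\beta^*$ for all $\alpha,\beta\in\mathbb F_n^+$. Then $\Gamma(\varphi):=\varphi(I)$ defines a bijection $\Gamma:CP(A,\mathcal V^m_{f,\mathcal P})\to C_{rad}(f,A)^+$. Moreover, let $D\in C_{rad}(f,A)^+$ and $R_r:=(id-\Phi_{f,rA})^m(D)$. For all $r<1$ close enough to $1$, the tuple $q_r=(f,m,rA,R_r,\mathcal P)$ is compatible, i.e. $\sum_{|\alpha|\ge1}a_\alpha r^{2|\alpha|}A_\alpha A_\alpha^*$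 is SOT-convergent, $R_r\ge0$, $\sum_{k\ge0}\binom{k+m-1}{m-1}\Phi_{f,rA}^k(R_r)\le bI$ for some $b>0$, and $p(rA)=0$ for $p\in\mathcal P$; the formula $$K_{q_r}h=(P_{\mathcal N_{\mathcal P}}\otimes I)\sum_{\alpha\in\mathbb F_n^+}\sqrt{b_\alpha}\;e_\alpha\otimes R_r^{1/2}(rA)_\alpha^*h,\qquad h\in\mathcal H,$$ defines a bounded operator $K_{q_r}:\mathcal H\to\mathcal N_{\mathcal P}\otimes\overline{R_r^{1/2}(\mathcal H)}$; and $$\Gamma^{-1}(D)[\chi]=\lim_{r\to1^-}K_{q_r}^*(\chi\otimes I)K_{q_r},\qquad\chi\in\mathcal S_{f,\mathcal P},$$ where the limit exists in the operator norm topology. -/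

import Mathlib

open Filter Topology
open scoped TensorProduct InnerProductSpace ComplexOrder

noncomputable section

namespace NCVariety

/-- The free semigroup `𝔽ₙ⁺` on `n` generators: words with concatenation `++`,
identity `[]` and length `List.length`. -/
abbrev Word (n : ℕ) : Type := List (Fin n)

/-- The monomial `X_α = X_{i₁} ⋯ X_{iₖ}` for `α = g_{i₁} ⋯ g_{iₖ}` (`X_{g₀} = 1`). -/
def wordProd {n : ℕ} {R : Type*} [Monoid R] (X : Fin n → R) (α : Word n) : R :=
  (α.map X).prod

/-- The coefficients of a positive regular free holomorphic function
`f = ∑_{|α| ≥ 1} a_α X_α` in `n` noncommuting variables. -/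
structure PosRegular (n : ℕ) where
  coeff : Word n → ℝ
  radius : limsup (fun k : ℕ =>
      ENNReal.ofReal ((∑ v : List.Vector (Fin n) k, |coeff v.toList| ^ 2) ^ (1 / (2 * k : ℝ))))
    atTop < ⊤
  nonneg : ∀ α, 0 ≤ coeff α
  coeff_nil : coeff [] = 0
  coeff_letter : ∀ i, 0 < coeff [i]

/-- The weights `b_α^{(m)} = ∑_{j} ∑_{γ₁ ⋯ γⱼ = α, |γᵢ| ≥ 1} a_{γ₁} ⋯ a_{γⱼ} C(j+m-1, m-1)`
(with value `1` at the empty word). Factorizations of `α` into `j` nonempty words are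
indexed by the compositions of `|α|` with `j` blocks. -/
def PosRegular.weight {n : ℕ} (f : PosRegular n) (m : ℕ) (α : Word n) : ℝ :=
  ∑ c : Composition α.length,
    ((α.splitWrtComposition c).map f.coeff).prod *
      ((c.length + (m - 1)).choose (m - 1) : ℝ)

theorem PosRegular.weight_nonneg {n : ℕ} (f : PosRegular n) (m : ℕ) (α : Word n) :
    0 ≤ f.weight m α := by
  refine Finset.sum_nonneg fun c _ => mul_nonneg (List.prod_nonneg ?_) (by positivity)
  intro x hx
  obtain ⟨γ, _, rfl⟩ := List.mem_map.1 hx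
  exact f.nonneg γ

theorem PosRegular.weight_nil {n : ℕ} (f : PosRegular n) (m : ℕ) : f.weight m [] = 1 := by
  have h : ∀ c : Composition ([] : Word n).length, c.blocks = [] := by
    intro c
    rcases hb : c.blocks with _ | ⟨a, l⟩
    · rfl
    · have h1 := c.blocks_sum
      have h2 : 0 < a := c.blocks_pos (by simp [hb])
      simp [hb] at h1
      omega
  have : Unique (Composition ([] : Word n).length) :=
    ⟨⟨Composition.ones 0⟩, fun c => Composition.ext ((h c).trans (h _).symm)⟩
  unfold PosRegular.weight
  rw [Fintype.sum_unique]
  simp [List.splitWrtComposition, h, Composition.length, List.splitWrtCompositionAux]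

theorem PosRegular.coeff_mul_weight_le {n : ℕ} (f : PosRegular n) (m : ℕ) (i : Fin n)
    (γ : Word n) : f.coeff [i] * f.weight m γ ≤ f.weight m (i :: γ) := by
  let e : Composition γ.length → Composition (i :: γ).length := fun c =>
    ⟨1 :: c.blocks, by
      intro j hj
      rcases List.mem_cons.1 hj with rfl | hj
      · exact one_pos
      · exact c.blocks_pos hj, by simp [add_comm]⟩
  have he : Function.Injective e := by
    intro c d h
    have := congrArg Composition.blocks h
    exact Composition.ext (by simpa [e] using this)
  have hnn : ∀ (α : Word n) (c : Composition α.length),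
      0 ≤ ((α.splitWrtComposition c).map f.coeff).prod := by
    intro α c
    refine List.prod_nonneg fun x hx => ?_
    obtain ⟨γ, _, rfl⟩ := List.mem_map.1 hx
    exact f.nonneg γ
  unfold PosRegular.weight
  rw [Finset.mul_sum]
  refine le_trans ?_ (Finset.sum_le_sum_of_subset_of_nonneg
    (Finset.subset_univ (Finset.univ.map ⟨e, he⟩))
    fun c _ _ => mul_nonneg (hnn _ c) (by positivity))
  rw [Finset.sum_map]
  refine Finset.sum_le_sum fun c _ => ?_
  have h1 : (i :: γ).splitWrtComposition (e c) = [i] :: γ.splitWrtComposition c := by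
    simp [List.splitWrtComposition, e, List.splitWrtCompositionAux]
  have h2 : (e c).length = c.length + 1 := by simp [e, Composition.length]
  have h3 : (c.length + (m - 1)).choose (m - 1) ≤
      ((e c).length + (m - 1)).choose (m - 1) := by
    rw [h2]
    exact Nat.choose_le_choose _ (by omega)
  have h3' : ((c.length + (m - 1)).choose (m - 1) : ℝ) ≤
      (((e c).length + (m - 1)).choose (m - 1) : ℝ) := by exact_mod_cast h3
  simp only [Function.Embedding.coeFn_mk]
  rw [h1, List.map_cons, List.prod_cons, ← mul_assoc]
  exact mul_le_mul_of_nonneg_left h3' (mul_nonneg (f.nonneg _) (hnn _ c))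

/-- The full Fock space `F²(Hₙ)`, realized as `ℓ²(𝔽ₙ⁺)` through its orthonormal basis
`e_α = e_{i₁} ⊗ ⋯ ⊗ e_{iₖ}`. -/
abbrev Fock (n : ℕ) : Type := lp (fun _ : Word n => ℂ) 2

/-- The basis vector `e_α`; `basisVec []` is the vacuum vector `1`. -/
def basisVec {n : ℕ} (α : Word n) : Fock n := lp.single 2 α (1 : ℂ)

/-- The coordinates of `x ↦ ∑_γ w_γ x_γ e_{g_i γ}`. -/
def shiftFun {n : ℕ} (i : Fin n) (w : Word n → ℝ) (x : Word n → ℂ) : Word n → ℂ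
  | [] => 0
  | j :: γ => if j = i then (w γ : ℂ) * x γ else 0

theorem hasSum_shiftFun {n : ℕ} (i : Fin n) (w : Word n → ℝ) (x : Word n → ℂ) (s : ℝ)
    (h : HasSum (fun γ => ‖(w γ : ℂ) * x γ‖ ^ 2) s) :
    HasSum (fun α => ‖shiftFun i w x α‖ ^ 2) s := by
  refine (Function.Injective.hasSum_iff (List.cons_injective (a := i)) ?_).1 ?_
  · intro α hα
    rcases α with _ | ⟨j, γ⟩
    · simp [shiftFun]
    · have : j ≠ i := fun hj => hα ⟨γ, by rw [hj]⟩
      simp [shiftFun, this]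
  · simpa [Function.comp_def, shiftFun] using h

theorem shiftFun_bound {n : ℕ} (i : Fin n) (w : Word n → ℝ) (C : ℝ)
    (hw : ∀ γ, |w γ| ≤ C) (x : Fock n) :
    Summable (fun α => ‖shiftFun i w x α‖ ^ 2) ∧
      ∑' α, ‖shiftFun i w x α‖ ^ 2 ≤ (C * ‖x‖) ^ 2 := by
  have hx : HasSum (fun γ => ‖x γ‖ ^ 2) (‖x‖ ^ 2) := by
    simpa using lp.hasSum_norm (p := 2) (by norm_num) x
  have hle : ∀ γ, ‖(w γ : ℂ) * x γ‖ ^ 2 ≤ C ^ 2 * ‖x γ‖ ^ 2 := by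
    intro γ
    rw [norm_mul, mul_pow, Complex.norm_real, Real.norm_eq_abs]
    gcongr
    exact hw γ
  have hs : Summable (fun γ => ‖(w γ : ℂ) * x γ‖ ^ 2) :=
    Summable.of_nonneg_of_le (fun _ => by positivity) hle (hx.summable.mul_left _)
  have h := hasSum_shiftFun i w x _ hs.hasSum
  refine ⟨h.summable, ?_⟩
  rw [h.tsum_eq, mul_pow, ← (hx.mul_left (C ^ 2)).tsum_eq]
  exact hs.tsum_le_tsum hle (hx.mul_left _).summable

/-- The bounded operator `e_γ ↦ w_γ e_{g_i γ}` on the Fock space, for a bounded family of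
weights. -/
def weightedShift {n : ℕ} (i : Fin n) (w : Word n → ℝ) (C : ℝ) (hw : ∀ γ, |w γ| ≤ C) :
    Fock n →L[ℂ] Fock n :=
  LinearMap.mkContinuous
    { toFun := fun x => ⟨shiftFun i w x, memℓp_gen (by
        simpa using (shiftFun_bound i w C hw x).1)⟩
      map_add' := by
        intro x y
        ext α
        change shiftFun i w (x + y : Fock n) α = shiftFun i w x α + shiftFun i w y α
        rcases α with _ | ⟨j, γ⟩
        · simp [shiftFun]
        · by_cases h : j = i <;> simp [shiftFun, h, mul_add]
      map_smul' := by
        intro c x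
        ext α
        change shiftFun i w (c • x : Fock n) α = c * shiftFun i w x α
        rcases α with _ | ⟨j, γ⟩
        · simp [shiftFun]
        · by_cases h : j = i <;> simp [shiftFun, h, mul_left_comm] }
    C (by
      intro x
      have hC : 0 ≤ C := (abs_nonneg _).trans (hw [])
      refine lp.norm_le_of_tsum_le (p := 2) (by norm_num) (by positivity) ?_
      simpa using (shiftFun_bound i w C hw x).2)

theorem weightedShift_basisVec {n : ℕ} (i : Fin n) (w : Word n → ℝ) (C : ℝ)
    (hw : ∀ γ, |w γ| ≤ C) (γ : Word n) :
    weightedShift i w C hw (basisVec γ) = (w γ : ℂ) • basisVec (i :: γ) := by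
  ext α
  change shiftFun i w (basisVec γ : Fock n) α = (w γ : ℂ) * (basisVec (i :: γ) : Fock n) α
  rcases α with _ | ⟨j, δ⟩
  · simp [shiftFun, basisVec]
  · by_cases h : j = i <;> by_cases h' : δ = γ <;>
      simp [shiftFun, basisVec, h, h']

theorem PosRegular.shiftWeight_bound {n : ℕ} (f : PosRegular n) (m : ℕ) (i : Fin n)
    (γ : Word n) :
    |√(f.weight m γ / f.weight m (i :: γ))| ≤ √(1 / f.coeff [i]) := by
  rw [abs_of_nonneg (Real.sqrt_nonneg _)]
  refine Real.sqrt_le_sqrt ?_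
  have h := f.coeff_mul_weight_le m i γ
  rcases (f.weight_nonneg m (i :: γ)).eq_or_lt with h0 | h0
  · rw [← h0, div_zero]
    exact div_nonneg zero_le_one (f.nonneg _)
  · rw [div_le_div_iff₀ h0 (f.coeff_letter i)]
    linarith

/-- The weighted left creation operators
`W_i e_γ = √(b_γ^{(m)} / b_{g_i γ}^{(m)}) e_{g_i γ}`: the universal model of `𝐃_f^m`. -/
def PosRegular.W {n : ℕ} (f : PosRegular n) (m : ℕ) (i : Fin n) : Fock n →L[ℂ] Fock n :=
  weightedShift i (fun γ => √(f.weight m γ / f.weight m (i :: γ)))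
    (√(1 / f.coeff [i])) (f.shiftWeight_bound m i)

section Operators

variable {n : ℕ} {H : Type*} [NormedAddCommGroup H] [InnerProductSpace ℂ H] [CompleteSpace H]

/-- Convergence of a sequence of operators in the weak operator topology. -/
def WOTTendsto (u : ℕ → H →L[ℂ] H) (T : H →L[ℂ] H) : Prop :=
  Tendsto (fun N => ContinuousLinearMapWOT.ofCLM (u N)) atTop
    (𝓝 (ContinuousLinearMapWOT.ofCLM T))

/-- Convergence of a sequence of operators in the strong operator topology. -/
def SOTTendsto (u : ℕ → H →L[ℂ] H) (T : H →L[ℂ] H) : Prop :=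
  ∀ x, Tendsto (fun N => u N x) atTop (𝓝 (T x))

/-- The partial sum `∑_{1 ≤ k ≤ N} ∑_{|α| = k} a_α X_α Y X_α^*`. -/
def PosRegular.partialSum (f : PosRegular n) (X : Fin n → H →L[ℂ] H) (Y : H →L[ℂ] H) (N : ℕ) :
    H →L[ℂ] H :=
  ∑ k ∈ Finset.Icc 1 N, ∑ v : List.Vector (Fin n) k,
    (f.coeff v.toList : ℂ) • (wordProd X v.toList * Y * star (wordProd X v.toList))

open Classical in
/-- `Φ_{f,X}(Y) = ∑_{k ≥ 1} ∑_{|α| = k} a_α X_α Y X_α^*`, with convergence in the weak operator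
topology (and the value `0` where the series does not converge). -/
def PosRegular.Phi (f : PosRegular n) (X : Fin n → H →L[ℂ] H) (Y : H →L[ℂ] H) : H →L[ℂ] H :=
  if h : ∃ T, WOTTendsto (f.partialSum X Y) T then h.choose else 0

/-- `(id - Φ_{f,X})^s (Y)`. -/
def PosRegular.defect (f : PosRegular n) (X : Fin n → H →L[ℂ] H) (s : ℕ) (Y : H →L[ℂ] H) :
    H →L[ℂ] H :=
  (fun Z => Z - f.Phi X Z)^[s] Y

/-- The noncommutative domain `𝐃_f^m(H)`. -/
def PosRegular.domain (f : PosRegular n) (m : ℕ) (H : Type*) [NormedAddCommGroup H]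
    [InnerProductSpace ℂ H] [CompleteSpace H] : Set (Fin n → H →L[ℂ] H) :=
  {X | (∃ T, WOTTendsto (f.partialSum X 1) T) ∧
    ∀ s ∈ Finset.Icc 1 m, 0 ≤ f.defect X s 1}

/-- The cone `C(f,A)⁺`. -/
def PosRegular.cone (f : PosRegular n) (m : ℕ) (A : Fin n → H →L[ℂ] H) : Set (H →L[ℂ] H) :=
  {D | 0 ≤ D ∧ ∀ s ∈ Finset.Icc 1 m, 0 ≤ f.defect A s D}

/-- The `n`-tuple `rA = (rA₁, …, rAₙ)`. -/
def dilate (r : ℝ) (A : Fin n → H →L[ℂ] H) : Fin n → H →L[ℂ] H := fun i => (r : ℂ) • A i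

/-- The set `C_rad(f,A)⁺`. -/
def PosRegular.coneRad (f : PosRegular n) (m : ℕ) (A : Fin n → H →L[ℂ] H) :
    Set (H →L[ℂ] H) :=
  {D | D ∈ f.cone m A ∧
    ∃ δ ∈ Set.Ioo (0 : ℝ) 1, ∀ r ∈ Set.Ioc δ 1, D ∈ f.cone m (dilate r A)}

/-- The evaluation `p(X₁, …, Xₙ)` of a noncommutative polynomial. -/
def polyEval (X : Fin n → H →L[ℂ] H) (p : FreeAlgebra ℂ (Fin n)) : H →L[ℂ] H :=
  FreeAlgebra.lift ℂ X p

end Operators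

/-- `𝐃_f^m` is a radial domain. -/
def PosRegular.IsRadial {n : ℕ} (f : PosRegular n) (m : ℕ) : Prop :=
  ∃ δ ∈ Set.Ioo (0 : ℝ) 1, ∀ r ∈ Set.Ioc δ 1, dilate r (f.W m) ∈ f.domain m (Fock n)

/-- Homogeneous noncommutative polynomials: linear combinations of monomials `X_α` with `|α|`
equal to a fixed `d`. -/
def IsHomogeneousPoly {n : ℕ} (p : FreeAlgebra ℂ (Fin n)) : Prop :=
  ∃ d : ℕ, p ∈ Submodule.span ℂ
    {q | ∃ α : Word n, α.length = d ∧ q = wordProd (FreeAlgebra.ι ℂ) α}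

section Variety

variable {n : ℕ} (f : PosRegular n) (m : ℕ) (P : Set (FreeAlgebra ℂ (Fin n)))

/-- `𝓜_P`, the closed span of the vectors `W_α p(W) W_β (1)`, `p ∈ P`. -/
def MSpace : Submodule ℂ (Fock n) :=
  (Submodule.span ℂ {x | ∃ p ∈ P, ∃ α β : Word n,
    x = wordProd (f.W m) α (polyEval (f.W m) p (wordProd (f.W m) β (basisVec [])))}
    ).topologicalClosure

/-- `𝓝_P = F²(Hₙ) ⊖ 𝓜_P`. -/
def NSpace : Submodule ℂ (Fock n) := (MSpace f m P)ᗮ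

instance : CompleteSpace (NSpace f m P) :=
  inferInstanceAs (CompleteSpace ((MSpace f m P)ᗮ : Submodule ℂ (Fock n)))

/-- The orthogonal projection of `F²(Hₙ)` onto `𝓝_P`. -/
def PN : Fock n →L[ℂ] NSpace f m P := (NSpace f m P).orthogonalProjectionOnto

/-- The universal model of the variety: `B_i = P_{𝓝_P} W_i |_{𝓝_P}`. -/
def BModel (i : Fin n) : NSpace f m P →L[ℂ] NSpace f m P :=
  PN f m P ∘L f.W m i ∘L (NSpace f m P).subtypeL

/-- `B_α B_β^*`. -/
def BB (α β : Word n) : NSpace f m P →L[ℂ] NSpace f m P :=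
  wordProd (BModel f m P) α * star (wordProd (BModel f m P) β)

/-- The operator system `𝓢_{f,P}`: the norm-closed span of the operators `B_α B_β^*`. -/
def OpSystem : Submodule ℂ (NSpace f m P →L[ℂ] NSpace f m P) :=
  (Submodule.span ℂ {T | ∃ α β : Word n, T = BB f m P α β}).topologicalClosure

theorem BB_mem (α β : Word n) : BB f m P α β ∈ OpSystem f m P :=
  Submodule.le_topologicalClosure _ (Submodule.subset_span ⟨α, β, rfl⟩)

theorem one_mem_OpSystem : 1 ∈ OpSystem f m P := by
  have h := BB_mem f m P [] []
  have h1 : BB f m P [] [] = 1 := by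
    simp only [BB, wordProd, List.map_nil, List.prod_nil, one_mul]
    exact star_one (NSpace f m P →L[ℂ] NSpace f m P)
  rwa [h1] at h

/-- `B_α B_β^*` as an element of `𝓢_{f,P}`. -/
def opBB (α β : Word n) : OpSystem f m P := ⟨BB f m P α β, BB_mem f m P α β⟩

/-- The identity as an element of `𝓢_{f,P}`. -/
def opOne : OpSystem f m P := ⟨1, one_mem_OpSystem f m P⟩

end Variety

/-- Positivity of an operator matrix `[T_{ij}]` acting on the direct sum of `k` copies of `E`. -/
def MatrixPos {E : Type*} [NormedAddCommGroup E] [InnerProductSpace ℂ E] {k : ℕ}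
    (T : Fin k → Fin k → E →L[ℂ] E) : Prop :=
  ∀ h : Fin k → E, 0 ≤ ∑ i, ∑ j, ⟪h i, T i j (h j)⟫_ℂ

/-- Complete positivity of a linear map on a subspace `S` of `B(E)`. -/
def IsCP {E H : Type*} [NormedAddCommGroup E] [InnerProductSpace ℂ E]
    [NormedAddCommGroup H] [InnerProductSpace ℂ H]
    {S : Submodule ℂ (E →L[ℂ] E)} (φ : S →ₗ[ℂ] (H →L[ℂ] H)) : Prop :=
  ∀ (k : ℕ) (T : Fin k → Fin k → S),
    MatrixPos (fun i j => (T i j : E →L[ℂ] E)) → MatrixPos (fun i j => φ (T i j))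

/-- `CP(A, 𝓥_{f,P}^m)`: the completely positive linear maps `φ : 𝓢_{f,P} → B(H)` with
`φ(B_α B_β^*) = A_α φ(I) A_β^*`. -/
def CPMaps {n : ℕ} (f : PosRegular n) (m : ℕ) (P : Set (FreeAlgebra ℂ (Fin n)))
    {H : Type*} [NormedAddCommGroup H] [InnerProductSpace ℂ H] [CompleteSpace H]
    (A : Fin n → H →L[ℂ] H) : Set (OpSystem f m P →ₗ[ℂ] (H →L[ℂ] H)) :=
  {φ | IsCP φ ∧ ∀ α β : Word n,
    φ (opBB f m P α β) = wordProd A α * φ (opOne f m P) * star (wordProd A β)}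

/-- The Hilbert space tensor product. -/
abbrev HTensor (E F : Type*) [NormedAddCommGroup E] [InnerProductSpace ℂ E]
    [NormedAddCommGroup F] [InnerProductSpace ℂ F] : Type _ :=
  UniformSpace.Completion (E ⊗[ℂ] F)

/-- The elementary tensor `x ⊗ y`. -/
def htmul {E F : Type*} [NormedAddCommGroup E] [InnerProductSpace ℂ E]
    [NormedAddCommGroup F] [InnerProductSpace ℂ F] (x : E) (y : F) : HTensor E F :=
  ((x ⊗ₜ[ℂ] y : E ⊗[ℂ] F) : UniformSpace.Completion (E ⊗[ℂ] F))

/-- The bounded operator `T ⊗ I_F`. -/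
def tensorId {E E' : Type*} (F : Type*) [NormedAddCommGroup E] [InnerProductSpace ℂ E]
    [NormedAddCommGroup E'] [InnerProductSpace ℂ E']
    [NormedAddCommGroup F] [InnerProductSpace ℂ F] (T : E →L[ℂ] E') :
    HTensor E F →L[ℂ] HTensor E' F :=
  (T.rTensor F).completion

theorem tensorId_htmul {E E' F : Type*} [NormedAddCommGroup E] [InnerProductSpace ℂ E]
    [NormedAddCommGroup E'] [InnerProductSpace ℂ E']
    [NormedAddCommGroup F] [InnerProductSpace ℂ F] (T : E →L[ℂ] E') (x : E) (y : F) :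
    tensorId F T (htmul x y) = htmul (T x) y := by
  simp [tensorId, htmul]

section Berezin

variable {n : ℕ} {H : Type*} [NormedAddCommGroup H] [InnerProductSpace ℂ H] [CompleteSpace H]

/-- `𝓡`, the closure of the range of `R^{1/2}`. -/
def RSpace (R : H →L[ℂ] H) : Submodule ℂ H :=
  (LinearMap.range (CFC.sqrt R).toLinearMap).topologicalClosure

instance (R : H →L[ℂ] H) : CompleteSpace (RSpace R) :=
  (Submodule.isClosed_topologicalClosure _).completeSpace_coe

/-- `R^{1/2} x` as an element of `𝓡`. -/
def sqrtVec (R : H →L[ℂ] H) (x : H) : RSpace R :=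
  ⟨CFC.sqrt R x, Submodule.le_topologicalClosure _ ⟨x, rfl⟩⟩

/-- `K` is the Berezin kernel `K_{f,A,R}^{(m)}`:
`K h = ∑_α √(b_α^{(m)}) e_α ⊗ R^{1/2} A_α^* h`. -/
def IsBerezinKernel (f : PosRegular n) (m : ℕ) (A : Fin n → H →L[ℂ] H) (R : H →L[ℂ] H)
    (K : H →L[ℂ] HTensor (Fock n) (RSpace R)) : Prop :=
  ∀ h, HasSum (fun α : Word n => (√(f.weight m α) : ℂ) •
    htmul (basisVec α) (sqrtVec R (star (wordProd A α) h))) (K h)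

open Classical in
/-- The Berezin kernel `K_{f,A,R}^{(m)}` (and `0` if the defining series does not give a bounded
operator). -/
def berezinKernel (f : PosRegular n) (m : ℕ) (A : Fin n → H →L[ℂ] H) (R : H →L[ℂ] H) :
    H →L[ℂ] HTensor (Fock n) (RSpace R) :=
  if h : ∃ K, IsBerezinKernel f m A R K then h.choose else 0

/-- The constrained Berezin kernel `K_q = (P_{𝓝_P} ⊗ I) K_{f,A,R}^{(m)}`. -/
def constrainedKernel (f : PosRegular n) (m : ℕ) (P : Set (FreeAlgebra ℂ (Fin n)))
    (A : Fin n → H →L[ℂ] H) (R : H →L[ℂ] H) :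
    H →L[ℂ] HTensor (NSpace f m P) (RSpace R) :=
  tensorId (RSpace R) (PN f m P) ∘L berezinKernel f m A R

/-- The Berezin transform `χ ↦ K_q^* (χ ⊗ I_𝓡) K_q` associated with `q = (f, m, A, R, P)`. -/
def berezinTransform (f : PosRegular n) (m : ℕ) (P : Set (FreeAlgebra ℂ (Fin n)))
    (A : Fin n → H →L[ℂ] H) (R : H →L[ℂ] H)
    (χ : NSpace f m P →L[ℂ] NSpace f m P) : H →L[ℂ] H :=
  ContinuousLinearMap.adjoint (constrainedKernel f m P A R) ∘L
    tensorId (RSpace R) χ ∘L constrainedKernel f m P A R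

/-- The series `∑_{|α| ≥ 1} a_α A_α A_α^*` is SOT-convergent. -/
def SOTSummable (f : PosRegular n) (A : Fin n → H →L[ℂ] H) : Prop :=
  ∃ T, SOTTendsto (f.partialSum A 1) T

/-- Compatibility of the tuple `q = (f, m, A, R, P)`. -/
structure Compatible (f : PosRegular n) (m : ℕ) (P : Set (FreeAlgebra ℂ (Fin n)))
    (A : Fin n → H →L[ℂ] H) (R : H →L[ℂ] H) : Prop where
  sot : SOTSummable f A
  pos : 0 ≤ R
  bound : ∃ T : H →L[ℂ] H, WOTTendsto (fun N => ∑ k ∈ Finset.range N,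
      (((k + (m - 1)).choose (m - 1) : ℕ) : ℂ) • (f.Phi A)^[k] R) T ∧
    ∃ b : ℝ, 0 < b ∧ T ≤ (b : ℂ) • (1 : H →L[ℂ] H)
  annihilates : ∀ p ∈ P, polyEval A p = 0

end Berezin

end NCVariety

end

noncomputable section

namespace NCVariety

/-! ### Monomials in words, and the exhaustion of the free semigroup by word length. -/

section Words

variable {n : ℕ} {R : Type*} [Monoid R]

/-! Write Φ_X for Φ_{f,X}. The proof has two halves, tied together by uniqueness.

From maps to the cone. A completely positive φ on the operator system is bounded, so the relation on
the generators B_α B_β^* extends by density to φ(B_γ T B_γ^*) = A_γ φ(T) A_γ^*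
(`pairMaps.map_conj`). For r < 1 the series Φ_{rB}(T) converges in norm, hence stays in the closed
operator system, and φ carries (id - Φ_{rB})^s(I) to (id - Φ_{rA})^s(φ(I)) (`pairMaps.map_defect`).
The space N_P is invariant under each W_i^*, so the defects of rB are compressions of those of rW,
which are positive by radiality (`inner_defect_dilate_coinvariant`). The case r = 1 follows by a
weak limit. Injectivity is continuity together with density of the span of the B_α B_β^*.

From the cone to maps. Let D be in the radial cone and R_r = (id - Φ_{rA})^m(D). Nonempty words gain
at least r², so Φ_{rA}(D) ≤ r² D and the iterates of Φ_{rA} on D decay geometrically. Summation by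
parts, i.e. the expansion of (1 - z)^{-m}, recovers D as ∑_k C(k+m-1, m-1) Φ_{rA}^k(R_r)
(`hasSum_iterate_phi_defect`). Regrouping the iterates by the factorizations of each word turns this
into D = ∑_α b_α (rA)_α R_r (rA)_α^* (`hasSum_weight_conjForm`), which says K^* K = D for the
Berezin kernel K. Moreover (W_i^* ⊗ I) K = K (rA_i)^*, so the homogeneous relations p(rA) = 0 push
the range of K into N_P ⊗ R (`IsBerezinKernel.tensorId_proj`).

It follows that χ ↦ K^*(χ ⊗ I)K is completely positive, bounded by ‖D‖ uniformly in r, and sends B_α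
B_β^* to r^{|α|+|β|} A_α D A_β^*. As r → 1 it converges on the generators, hence in norm on the
whole operator system, and the limit is a preimage of D (`exists_pairMap_of_tendsto`). By
injectivity it is the only one. -/

@[simp] theorem wordProd_nil (X : Fin n → R) : wordProd X [] = 1 := rfl

@[simp] theorem wordProd_cons (X : Fin n → R) (i : Fin n) (α : Word n) :
    wordProd X (i :: α) = X i * wordProd X α := by
  simp [wordProd]

theorem wordProd_append (X : Fin n → R) (α β : Word n) :
    wordProd X (α ++ β) = wordProd X α * wordProd X β := by
  simp [wordProd]

/-- The nonempty words of length at most `N`. -/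
def wordBall (n N : ℕ) : Finset (Word n) :=
  ((Finset.Icc 1 N).sigma fun k => (Finset.univ : Finset (List.Vector (Fin n) k))).map
    ⟨fun p => p.2.toList, by
      rintro ⟨k, v⟩ ⟨l, w⟩ h
      obtain ⟨v, rfl⟩ := v
      obtain ⟨w, rfl⟩ := w
      change v = w at h
      subst h
      rfl⟩

theorem mem_wordBall {N : ℕ} {α : Word n} :
    α ∈ wordBall n N ↔ 1 ≤ α.length ∧ α.length ≤ N := by
  simp only [wordBall, Finset.mem_map, Finset.mem_sigma, Finset.mem_Icc, Finset.mem_univ,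
    and_true, Sigma.exists]
  constructor
  · rintro ⟨k, v, h, rfl⟩
    change 1 ≤ v.toList.length ∧ v.toList.length ≤ N
    rwa [v.toList_length]
  · intro h
    exact ⟨α.length, ⟨α, rfl⟩, h, rfl⟩

theorem sum_wordBall {M : Type*} [AddCommMonoid M] (F : Word n → M) (N : ℕ) :
    ∑ α ∈ wordBall n N, F α =
      ∑ k ∈ Finset.Icc 1 N, ∑ v : List.Vector (Fin n) k, F v.toList := by
  rw [wordBall, Finset.sum_map, Finset.sum_sigma]
  rfl

theorem tendsto_insert_wordBall :
    Tendsto (fun N => insert [] (wordBall n N)) atTop (atTop : Filter (Finset (Word n))) := by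
  refine tendsto_atTop_finset_of_monotone ?_ fun α => ⟨α.length, ?_⟩
  · intro N M h
    refine Finset.insert_subset_insert _ fun α => ?_
    simp only [mem_wordBall]
    omega
  · rcases α with _ | ⟨i, α⟩
    · simp
    · simp [mem_wordBall]

theorem HasSum.tendsto_wordBall {M : Type*} [AddCommMonoid M] [TopologicalSpace M]
    {F : Word n → M} {a : M} (h : HasSum F a) (h0 : F [] = 0) :
    Tendsto (fun N => ∑ α ∈ wordBall n N, F α) atTop (𝓝 a) := by
  refine (Tendsto.comp h tendsto_insert_wordBall).congr fun N => ?_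
  simp only [Function.comp_apply]
  rw [Finset.sum_insert (by simp [mem_wordBall]), h0, zero_add]

end Words

/-! ### The map Φ for a bounded row: convergence, linearity, positivity. -/

section Rows

variable {n : ℕ} {H : Type*} [NormedAddCommGroup H] [InnerProductSpace ℂ H] [CompleteSpace H]
  {f : PosRegular n} {X : Fin n → H →L[ℂ] H} {C : ℝ}

/-- The summand `a_α X_α Y X_α^*` of `Φ_{f,X}(Y)`. -/
def PosRegular.term (f : PosRegular n) (X : Fin n → H →L[ℂ] H) (Y : H →L[ℂ] H) (α : Word n) :
    H →L[ℂ] H :=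
  (f.coeff α : ℂ) • (wordProd X α * Y * star (wordProd X α))

/-- `a_α ‖X_α^* x‖²`. -/
def PosRegular.sqTerm (f : PosRegular n) (X : Fin n → H →L[ℂ] H) (x : H) (α : Word n) : ℝ :=
  f.coeff α * ‖star (wordProd X α) x‖ ^ 2

theorem PosRegular.sqTerm_nonneg (x : H) (α : Word n) : 0 ≤ f.sqTerm X x α :=
  mul_nonneg (f.nonneg α) (by positivity)

theorem PosRegular.term_nil (Y : H →L[ℂ] H) : f.term X Y [] = 0 := by
  simp [PosRegular.term, f.coeff_nil]

theorem PosRegular.partialSum_eq (Y : H →L[ℂ] H) (N : ℕ) :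
    f.partialSum X Y N = ∑ α ∈ wordBall n N, f.term X Y α :=
  (sum_wordBall (f.term X Y) N).symm

theorem inner_mul_mul_star (S Y : H →L[ℂ] H) (x y : H) :
    ⟪(S * Y * star S) x, y⟫_ℂ = ⟪Y (star S x), star S y⟫_ℂ := by
  simp only [ContinuousLinearMap.star_eq_adjoint, mul_apply_eq_comp]
  rw [ContinuousLinearMap.adjoint_inner_right]

theorem PosRegular.inner_term (Y : H →L[ℂ] H) (α : Word n) (x y : H) :
    ⟪f.term X Y α x, y⟫_ℂ =
      f.coeff α * ⟪Y (star (wordProd X α) x), star (wordProd X α) y⟫_ℂ := by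
  rw [PosRegular.term, smul_apply, inner_smul_left, inner_mul_mul_star,
    Complex.conj_ofReal]

theorem PosRegular.inner_term_one (α : Word n) (x : H) :
    ⟪f.term X 1 α x, x⟫_ℂ = f.sqTerm X x α := by
  rw [PosRegular.inner_term, one_apply_eq_self, inner_self_eq_norm_sq_to_K,
    PosRegular.sqTerm]
  push_cast
  rfl

/-- The row `(√a_α X_α)_α` has norm at most `√C`. -/
def RowBounded (f : PosRegular n) (X : Fin n → H →L[ℂ] H) (C : ℝ) : Prop :=
  ∀ (s : Finset (Word n)) (x : H), ∑ α ∈ s, f.sqTerm X x α ≤ C * ‖x‖ ^ 2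

theorem WOTTendsto.inner {u : ℕ → H →L[ℂ] H} {T : H →L[ℂ] H} (h : WOTTendsto u T) (x y : H) :
    Tendsto (fun N => ⟪y, u N x⟫_ℂ) atTop (𝓝 ⟪y, T x⟫_ℂ) :=
  ContinuousLinearMapWOT.tendsto_iff_forall_inner_apply_tendsto.1 h x y

theorem WOTTendsto.unique {u : ℕ → H →L[ℂ] H} {S T : H →L[ℂ] H} (h : WOTTendsto u S)
    (h' : WOTTendsto u T) : S = T :=
  ContinuousLinearMapWOT.ofCLM_injective (tendsto_nhds_unique h h')

theorem SOTTendsto.wot {u : ℕ → H →L[ℂ] H} {T : H →L[ℂ] H} (h : SOTTendsto u T) :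
    WOTTendsto u T :=
  ContinuousLinearMapWOT.tendsto_iff_forall_inner_apply_tendsto.2 fun x _ =>
    tendsto_const_nhds.inner (h x)

/-- The quadratic forms of the partial sums increase with N to ⟪x, T x⟫, so every finite subsum is
dominated by the limit. The empty word, absent from `wordBall`, has coefficient 0. -/
theorem rowBounded_of_wotTendsto {T : H →L[ℂ] H} (h : WOTTendsto (f.partialSum X 1) T) :
    RowBounded f X ‖T‖ := by
  have hmono : ∀ x, Monotone fun N => ∑ α ∈ wordBall n N, f.sqTerm X x α := fun x N M hNM =>
    Finset.sum_le_sum_of_subset_of_nonneg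
      (fun α => by simp only [mem_wordBall]; omega) fun α _ _ => f.sqTerm_nonneg x α
  have hlim : ∀ x, Tendsto (fun N => ∑ α ∈ wordBall n N, f.sqTerm X x α) atTop
      (𝓝 (Complex.re ⟪x, T x⟫_ℂ)) := by
    intro x
    refine ((Complex.continuous_re.tendsto _).comp (h.inner x x)).congr fun N => ?_
    have : ⟪f.partialSum X 1 N x, x⟫_ℂ = ((∑ α ∈ wordBall n N, f.sqTerm X x α : ℝ) : ℂ) := by
      rw [PosRegular.partialSum_eq, sum_apply, sum_inner]
      push_cast
      exact Finset.sum_congr rfl fun α _ => f.inner_term_one α x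
    simp only [Function.comp_apply]
    rw [← inner_conj_symm, this, Complex.conj_ofReal, Complex.ofReal_re]
  intro s x
  have hT : Complex.re ⟪x, T x⟫_ℂ ≤ ‖T‖ * ‖x‖ ^ 2 := by
    calc Complex.re ⟪x, T x⟫_ℂ ≤ ‖x‖ * ‖T x‖ := re_inner_le_norm (𝕜 := ℂ) x (T x)
      _ ≤ ‖x‖ * (‖T‖ * ‖x‖) := by gcongr; exact T.le_opNorm x
      _ = _ := by ring
  have hs : s \ {[]} ⊆ wordBall n (s.sup List.length) := by
    intro α hα
    simp only [Finset.mem_sdiff, Finset.mem_singleton] at hα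
    rw [mem_wordBall]
    exact ⟨List.length_pos_iff.2 hα.2, Finset.le_sup (f := List.length) hα.1⟩
  calc ∑ α ∈ s, f.sqTerm X x α = ∑ α ∈ s \ {[]}, f.sqTerm X x α := by
        refine (Finset.sum_subset Finset.sdiff_subset fun α h1 h2 => ?_).symm
        have : α = [] := by simpa [h1] using h2
        simp [this, PosRegular.sqTerm, f.coeff_nil]
    _ ≤ _ := Finset.sum_le_sum_of_subset_of_nonneg hs fun α _ _ => f.sqTerm_nonneg x α
    _ ≤ _ := (hmono x).ge_of_tendsto (hlim x) _
    _ ≤ _ := hT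

theorem RowBounded.summable (h : RowBounded f X C) (x : H) : Summable (f.sqTerm X x) :=
  summable_of_sum_le (f.sqTerm_nonneg x) fun s => h s x

theorem norm_sum_term_apply_le (Y : H →L[ℂ] H) (s : Finset (Word n)) (x y : H) :
    ‖⟪∑ α ∈ s, f.term X Y α x, y⟫_ℂ‖ ≤
      ‖Y‖ * (√(∑ α ∈ s, f.sqTerm X x α) * √(∑ α ∈ s, f.sqTerm X y α)) := by
  rw [sum_inner]
  have h1 : ∀ α, ‖⟪f.term X Y α x, y⟫_ℂ‖ ≤
      ‖Y‖ * ((√(f.coeff α) * ‖star (wordProd X α) x‖) *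
        (√(f.coeff α) * ‖star (wordProd X α) y‖)) := by
    intro α
    rw [f.inner_term, norm_mul, Complex.norm_real, Real.norm_of_nonneg (f.nonneg α)]
    calc f.coeff α * ‖⟪Y (star (wordProd X α) x), star (wordProd X α) y⟫_ℂ‖
        ≤ f.coeff α * (‖Y‖ * ‖star (wordProd X α) x‖ * ‖star (wordProd X α) y‖) := by
          gcongr
          · exact f.nonneg α
          · exact (norm_inner_le_norm _ _).trans (by gcongr; exact Y.le_opNorm _)
      _ = (√(f.coeff α) * √(f.coeff α)) *
          (‖Y‖ * ‖star (wordProd X α) x‖ * ‖star (wordProd X α) y‖) := by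
          rw [Real.mul_self_sqrt (f.nonneg α)]
      _ = _ := by ring
  refine (norm_sum_le _ _).trans ((Finset.sum_le_sum fun α _ => h1 α).trans ?_)
  rw [← Finset.mul_sum]
  gcongr
  have h2 : ∀ z α, f.sqTerm X z α = (√(f.coeff α) * ‖star (wordProd X α) z‖) ^ 2 := by
    intro z α
    rw [mul_pow, Real.sq_sqrt (f.nonneg α), PosRegular.sqTerm]
  simp only [h2]
  exact Real.sum_mul_le_sqrt_mul_sqrt _ _ _

/-- Testing the sum against itself and using Cauchy–Schwarz. Keeping the bound C' at the given x
apart from the uniform C makes a tail small as soon as the scalar tail at x is small. -/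
theorem norm_sum_term_le {s : Finset (Word n)} {C' : ℝ}
    (hC : 0 ≤ C) (h : ∀ x, ∑ α ∈ s, f.sqTerm X x α ≤ C * ‖x‖ ^ 2)
    (Y : H →L[ℂ] H) (x : H) (h' : ∑ α ∈ s, f.sqTerm X x α ≤ C') :
    ‖∑ α ∈ s, f.term X Y α x‖ ≤ ‖Y‖ * (√C * √C') := by
  set z := ∑ α ∈ s, f.term X Y α x
  rcases eq_or_ne z 0 with hz | hz
  · rw [hz, norm_zero]; positivity
  have h1 := norm_sum_term_apply_le (f := f) (X := X) Y s x z
  rw [inner_self_eq_norm_sq_to_K] at h1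
  have h2 : √(∑ α ∈ s, f.sqTerm X z α) ≤ √C * ‖z‖ := by
    rw [← Real.sqrt_sq (norm_nonneg z), ← Real.sqrt_mul hC]
    exact Real.sqrt_le_sqrt (h z)
  have h3 : ‖z‖ * ‖z‖ ≤ (‖Y‖ * (√C * √C')) * ‖z‖ := by
    calc ‖z‖ * ‖z‖ = ‖((‖z‖ : ℂ)) ^ 2‖ := by simp [sq]
      _ ≤ _ := h1
      _ ≤ ‖Y‖ * (√C' * (√C * ‖z‖)) := by gcongr
      _ = _ := by ring
  exact le_of_mul_le_mul_right h3 (norm_pos_iff.2 hz)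

theorem RowBounded.mono {C' : ℝ} (h : RowBounded f X C) (hC : C ≤ C') : RowBounded f X C' :=
  fun s x => (h s x).trans (by gcongr)

theorem RowBounded.norm_sum_le (h : RowBounded f X C) (hC : 0 ≤ C) (Y : H →L[ℂ] H)
    (s : Finset (Word n)) (x : H) : ‖∑ α ∈ s, f.term X Y α x‖ ≤ C * ‖Y‖ * ‖x‖ := by
  refine (norm_sum_term_le hC (h s) Y x (h s x)).trans_eq ?_
  rw [Real.sqrt_mul hC, Real.sqrt_sq (norm_nonneg x), ← mul_assoc √C, Real.mul_self_sqrt hC]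
  ring

theorem RowBounded.summable_term (h : RowBounded f X C) (hC : 0 ≤ C) (Y : H →L[ℂ] H) (x : H) :
    Summable fun α => f.term X Y α x := by
  rw [summable_iff_vanishing_norm]
  intro ε hε
  obtain ⟨δ, hδ, hδ'⟩ : ∃ δ : ℝ, 0 < δ ∧ ‖Y‖ * (√C * √δ) < ε := by
    have : Tendsto (fun δ : ℝ => ‖Y‖ * (√C * √δ)) (𝓝[>] 0) (𝓝 0) := by
      refine tendsto_nhdsWithin_of_tendsto_nhds ?_
      have : Continuous fun δ : ℝ => ‖Y‖ * (√C * √δ) := by fun_prop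
      simpa using this.tendsto 0
    obtain ⟨δ, h1, h2⟩ := ((this.eventually_lt_const hε).and self_mem_nhdsWithin).exists
    exact ⟨δ, h2, h1⟩
  obtain ⟨s, hs⟩ := summable_iff_vanishing_norm.1 (h.summable x) δ hδ
  refine ⟨s, fun t ht => lt_of_le_of_lt (norm_sum_term_le hC (h t) Y x ?_) hδ'⟩
  exact (le_abs_self _).trans (hs t ht).le

/-- `Φ_{f,X}(Y)` as the operator of the pointwise norm convergent series. -/
def RowBounded.op (h : RowBounded f X C) (hC : 0 ≤ C) (Y : H →L[ℂ] H) : H →L[ℂ] H :=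
  LinearMap.mkContinuous
    { toFun := fun x => ∑' α, f.term X Y α x
      map_add' := fun x y => by
        simp only [map_add]
        exact (h.summable_term hC Y x).tsum_add (h.summable_term hC Y y)
      map_smul' := fun c x => by
        simp only [map_smul, RingHom.id_apply]
        exact (h.summable_term hC Y x).tsum_const_smul c }
    (C * ‖Y‖) fun x =>
      le_of_tendsto (h.summable_term hC Y x).hasSum.norm
        (Eventually.of_forall fun s => h.norm_sum_le hC Y s x)

/-- Replaces the chosen weak limit in `PosRegular.Phi` by an unconditional pointwise sum. The
algebra and positivity of Φ are read off from this. -/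
theorem hasSum_phi (h : RowBounded f X C) (hC : 0 ≤ C) (Y : H →L[ℂ] H) (x : H) :
    HasSum (fun α => f.term X Y α x) (f.Phi X Y x) := by
  have h1 : ∀ x, HasSum (fun α => f.term X Y α x) (h.op hC Y x) := fun x =>
    (h.summable_term hC Y x).hasSum
  have h2 : WOTTendsto (f.partialSum X Y) (h.op hC Y) := by
    refine SOTTendsto.wot fun x => ?_
    have := HasSum.tendsto_wordBall (h1 x) (by simp [f.term_nil])
    refine this.congr fun N => ?_
    rw [f.partialSum_eq, sum_apply]
  have h3 : ∃ T, WOTTendsto (f.partialSum X Y) T := ⟨_, h2⟩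
  have h4 : f.Phi X Y = h.op hC Y := by
    rw [PosRegular.Phi, dif_pos h3]
    exact h3.choose_spec.unique h2
  rw [h4]
  exact h1 x

theorem norm_phi_le (h : RowBounded f X C) (hC : 0 ≤ C) (Y : H →L[ℂ] H) :
    ‖f.Phi X Y‖ ≤ C * ‖Y‖ :=
  ContinuousLinearMap.opNorm_le_bound _ (by positivity) fun x =>
    le_of_tendsto (hasSum_phi h hC Y x).norm
      (Eventually.of_forall fun s => h.norm_sum_le hC Y s x)

theorem phi_eq (h : RowBounded f X C) (hC : 0 ≤ C) {Y T : H →L[ℂ] H}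
    (hT : ∀ x, HasSum (fun α => f.term X Y α x) (T x)) : f.Phi X Y = T :=
  ContinuousLinearMap.ext fun x => (hasSum_phi h hC Y x).unique (hT x)

theorem phi_add (h : RowBounded f X C) (hC : 0 ≤ C) (Y Z : H →L[ℂ] H) :
    f.Phi X (Y + Z) = f.Phi X Y + f.Phi X Z := by
  refine phi_eq h hC fun x => ?_
  refine ((hasSum_phi h hC Y x).add (hasSum_phi h hC Z x)).congr_fun ?_
  intro α
  simp [PosRegular.term, mul_add, add_mul]

theorem phi_smul (h : RowBounded f X C) (hC : 0 ≤ C) (c : ℂ) (Y : H →L[ℂ] H) :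
    f.Phi X (c • Y) = c • f.Phi X Y := by
  refine phi_eq h hC fun x => ?_
  refine ((hasSum_phi h hC Y x).const_smul c).congr_fun ?_
  intro α
  rw [PosRegular.term, mul_smul_comm, smul_mul_assoc, smul_comm]
  rfl

/-- `Φ_{f,X}` as a linear map. -/
def phiLin (h : RowBounded f X C) (hC : 0 ≤ C) : (H →L[ℂ] H) →ₗ[ℂ] (H →L[ℂ] H) where
  toFun := f.Phi X
  map_add' := phi_add h hC
  map_smul' := phi_smul h hC

theorem hasSum_inner_phi (h : RowBounded f X C) (hC : 0 ≤ C) (Y : H →L[ℂ] H) (x y : H) :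
    HasSum (fun α => (f.coeff α : ℂ) * ⟪Y (star (wordProd X α) x), star (wordProd X α) y⟫_ℂ)
      ⟪f.Phi X Y x, y⟫_ℂ := by
  have := (innerSLFlip ℂ y).hasSum (hasSum_phi h hC Y x)
  simpa only [innerSLFlip_apply_apply, PosRegular.inner_term] using this

theorem nonneg_iff_inner {T : H →L[ℂ] H} : 0 ≤ T ↔ ∀ x, 0 ≤ ⟪T x, x⟫_ℂ := by
  rw [ContinuousLinearMap.nonneg_iff_isPositive, ContinuousLinearMap.isPositive_iff_complex]
  refine forall_congr' fun x => ?_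
  rw [Complex.nonneg_iff]
  constructor
  · rintro ⟨h1, h2⟩
    exact ⟨h2, by rw [← h1]; simp⟩
  · rintro ⟨h1, h2⟩
    exact ⟨Complex.ext (by simp) (by simpa using h2), h1⟩

theorem phi_nonneg (h : RowBounded f X C) (hC : 0 ≤ C) {Y : H →L[ℂ] H} (hY : 0 ≤ Y) :
    0 ≤ f.Phi X Y := by
  rw [nonneg_iff_inner] at hY ⊢
  intro x
  exact (hasSum_inner_phi h hC Y x x).nonneg
    fun α => mul_nonneg (by exact_mod_cast f.nonneg α) (hY _)

theorem phi_mono (h : RowBounded f X C) (hC : 0 ≤ C) {Y Z : H →L[ℂ] H} (hYZ : Y ≤ Z) :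
    f.Phi X Y ≤ f.Phi X Z := by
  have := phi_nonneg h hC (sub_nonneg.2 hYZ)
  have h2 := (phiLin h hC).map_sub Z Y
  change f.Phi X (Z - Y) = f.Phi X Z - f.Phi X Y at h2
  rwa [h2, sub_nonneg] at this

end Rows

/-! ### The dilations rX: norm convergence for r < 1, and the limit r → 1. -/

section Dilation

variable {n : ℕ} {H : Type*} [NormedAddCommGroup H] [InnerProductSpace ℂ H] [CompleteSpace H]
  {f : PosRegular n} {X : Fin n → H →L[ℂ] H} {C : ℝ}

theorem wordProd_dilate (r : ℝ) (X : Fin n → H →L[ℂ] H) (α : Word n) :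
    wordProd (dilate r X) α = (r : ℂ) ^ α.length • wordProd X α := by
  induction α with
  | nil => simp
  | cons i α ih =>
    rw [wordProd_cons, ih, wordProd_cons, dilate, smul_mul_smul_comm, List.length_cons, pow_succ']

theorem star_wordProd_dilate (r : ℝ) (X : Fin n → H →L[ℂ] H) (α : Word n) :
    star (wordProd (dilate r X) α) = (r : ℂ) ^ α.length • star (wordProd X α) := by
  rw [wordProd_dilate, star_smul, star_pow]
  simp

theorem PosRegular.term_dilate (r : ℝ) (Y : H →L[ℂ] H) (α : Word n) :
    f.term (dilate r X) Y α = ((r : ℂ) ^ 2) ^ α.length • f.term X Y α := by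
  rw [PosRegular.term, star_wordProd_dilate, wordProd_dilate, PosRegular.term, smul_mul_assoc,
    smul_mul_smul_comm, smul_comm, ← pow_mul, mul_comm 2, pow_mul, sq]

theorem PosRegular.sqTerm_dilate (r : ℝ) (x : H) (α : Word n) :
    f.sqTerm (dilate r X) x α = (r ^ 2) ^ α.length * f.sqTerm X x α := by
  rw [PosRegular.sqTerm, star_wordProd_dilate, smul_apply, norm_smul,
    PosRegular.sqTerm, mul_pow, norm_pow, Complex.norm_real, Real.norm_eq_abs, ← pow_mul,
    mul_comm _ 2, pow_mul, sq_abs]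
  ring

theorem RowBounded.sum_dilate_le (h : RowBounded f X C) {r : ℝ} (hr : r ∈ Set.Icc (0 : ℝ) 1)
    {N : ℕ} {s : Finset (Word n)} (hs : ∀ α ∈ s, N ≤ α.length) (x : H) :
    ∑ α ∈ s, f.sqTerm (dilate r X) x α ≤ ((r ^ 2) ^ N * C) * ‖x‖ ^ 2 := by
  rw [mul_assoc]
  refine le_trans ?_ (mul_le_mul_of_nonneg_left (h s x) (by positivity))
  rw [Finset.mul_sum]
  refine Finset.sum_le_sum fun α hα => ?_
  rw [f.sqTerm_dilate]
  exact mul_le_mul_of_nonneg_right (pow_le_pow_of_le_one (by positivity)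
    (pow_le_one₀ hr.1 hr.2) (hs α hα)) (f.sqTerm_nonneg x α)

theorem RowBounded.dilate (h : RowBounded f X C) {r : ℝ} (hr : r ∈ Set.Icc (0 : ℝ) 1) :
    RowBounded f (dilate r X) C := fun s x => by
  simpa using h.sum_dilate_le hr (N := 0) (s := s) (by simp) x

/-- Words of length at least N contribute at most r^{2N} C ‖Y‖ in norm. Norm convergence, not merely
strong, is what keeps Φ inside a norm-closed operator system. -/
theorem hasSum_phi_dilate (h : RowBounded f X C) (hC : 0 ≤ C) {r : ℝ}
    (hr : r ∈ Set.Ico (0 : ℝ) 1) (Y : H →L[ℂ] H) :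
    HasSum (f.term (dilate r X) Y) (f.Phi (dilate r X) Y) := by
  have hr' : r ∈ Set.Icc (0 : ℝ) 1 := ⟨hr.1, hr.2.le⟩
  have hs : Summable (f.term (NCVariety.dilate r X) Y) := by
    rw [summable_iff_vanishing_norm]
    intro ε hε
    have hq : r ^ 2 < 1 := pow_lt_one₀ hr.1 hr.2 two_ne_zero
    have ht : Tendsto (fun N : ℕ => (r ^ 2) ^ N * C * ‖Y‖) atTop (𝓝 0) := by
      simpa using ((tendsto_pow_atTop_nhds_zero_of_lt_one (by positivity) hq).mul_const C).mul_const
        ‖Y‖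
    obtain ⟨N, hN⟩ := (ht.eventually_lt_const hε).exists
    -- Any word outside this finite set is longer than N.
    refine ⟨insert [] (wordBall n N), fun t ht => lt_of_le_of_lt ?_ hN⟩
    have hC' : 0 ≤ (r ^ 2) ^ N * C := by positivity
    refine ContinuousLinearMap.opNorm_le_bound _ (by positivity) fun x => ?_
    have hlen : ∀ α ∈ t, N ≤ α.length := by
      intro α hα
      have h1 := Finset.disjoint_left.1 ht hα
      simp only [Finset.mem_insert, mem_wordBall, not_or, not_and, not_le] at h1
      exact (h1.2 (List.length_pos_iff.2 h1.1)).le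
    rw [sum_apply]
    refine (norm_sum_term_le hC' (h.sum_dilate_le hr' hlen) Y x
      (h.sum_dilate_le hr' hlen x)).trans_eq ?_
    rw [Real.sqrt_mul hC', Real.sqrt_sq (norm_nonneg x), ← mul_assoc (√_),
      Real.mul_self_sqrt hC']
    ring
  have h2 : ∑' α, f.term (NCVariety.dilate r X) Y α = f.Phi (NCVariety.dilate r X) Y := by
    ext x
    exact (hs.hasSum.mapL (ContinuousLinearMap.apply ℂ H x)).unique
      (hasSum_phi (h.dilate hr') hC Y x)
  exact h2 ▸ hs.hasSum

/-- Dominated convergence over words, with majorant M a_α ‖X_α^* x‖². The argument Y varies with the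
index so that the statement can be iterated through the defects. -/
theorem tendsto_inner_phi_dilate (h : RowBounded f X C) (hC : 0 ≤ C) {ι : Type*} {l : Filter ι}
    {r : ι → ℝ} (hr : ∀ᶠ i in l, r i ∈ Set.Icc (0 : ℝ) 1) (hr1 : Tendsto r l (𝓝 1))
    {Y : ι → H →L[ℂ] H} {Z : H →L[ℂ] H} {M : ℝ} (hY : ∀ᶠ i in l, ‖Y i‖ ≤ M)
    (hYZ : ∀ x, Tendsto (fun i => ⟪Y i x, x⟫_ℂ) l (𝓝 ⟪Z x, x⟫_ℂ)) (x : H) :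
    Tendsto (fun i => ⟪f.Phi (dilate (r i) X) (Y i) x, x⟫_ℂ) l (𝓝 ⟪f.Phi X Z x, x⟫_ℂ) := by
  have h1 : ∀ᶠ i in l, ∑' α, ((r i : ℂ) ^ 2) ^ α.length * ⟪f.term X (Y i) α x, x⟫_ℂ =
      ⟪f.Phi (NCVariety.dilate (r i) X) (Y i) x, x⟫_ℂ := by
    filter_upwards [hr] with i hi
    refine Eq.trans (tsum_congr fun α => ?_)
      ((innerSLFlip ℂ x).hasSum (hasSum_phi (h.dilate hi) hC (Y i) x)).tsum_eq
    rw [innerSLFlip_apply_apply, f.term_dilate, smul_apply, inner_smul_left]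
    simp
  have h2 : ∑' α, ⟪f.term X Z α x, x⟫_ℂ = ⟪f.Phi X Z x, x⟫_ℂ :=
    ((innerSLFlip ℂ x).hasSum (hasSum_phi h hC Z x)).tsum_eq
  rw [← h2]
  refine Tendsto.congr' h1 ?_
  refine tendsto_tsum_of_dominated_convergence (bound := fun α => M * f.sqTerm X x α)
    ((h.summable x).mul_left M) (fun α => ?_) ?_
  · have h3 : Tendsto (fun i => ((r i : ℂ) ^ 2) ^ α.length) l (𝓝 1) := by
      have := (((Complex.continuous_ofReal.tendsto 1).comp hr1).pow 2).pow α.length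
      simpa using this
    have h4 : Tendsto (fun i => ⟪f.term X (Y i) α x, x⟫_ℂ) l (𝓝 ⟪f.term X Z α x, x⟫_ℂ) := by
      simp only [f.inner_term]
      exact (hYZ _).const_mul _
    simpa using h3.mul h4
  · filter_upwards [hr, hY] with i hi hiY α
    rw [norm_mul, norm_pow, norm_pow, Complex.norm_real, Real.norm_of_nonneg hi.1]
    calc (r i ^ 2) ^ α.length * ‖⟪f.term X (Y i) α x, x⟫_ℂ‖
        ≤ 1 * ‖⟪f.term X (Y i) α x, x⟫_ℂ‖ := by
          gcongr
          exact pow_le_one₀ (by positivity) (pow_le_one₀ hi.1 hi.2)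
      _ ≤ ‖Y i‖ * (√(f.sqTerm X x α) * √(f.sqTerm X x α)) := by
          simpa using norm_sum_term_apply_le (f := f) (X := X) (Y i) {α} x x
      _ = ‖Y i‖ * f.sqTerm X x α := by rw [Real.mul_self_sqrt (f.sqTerm_nonneg x α)]
      _ ≤ _ := mul_le_mul_of_nonneg_right hiY (f.sqTerm_nonneg x α)

theorem PosRegular.defect_zero (Y : H →L[ℂ] H) : f.defect X 0 Y = Y := rfl

theorem PosRegular.defect_succ (s : ℕ) (Y : H →L[ℂ] H) :
    f.defect X (s + 1) Y = f.defect X s Y - f.Phi X (f.defect X s Y) := by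
  simp only [PosRegular.defect, Function.iterate_succ_apply']

theorem norm_defect_le (h : RowBounded f X C) (hC : 0 ≤ C) (s : ℕ) (Y : H →L[ℂ] H) :
    ‖f.defect X s Y‖ ≤ (1 + C) ^ s * ‖Y‖ := by
  induction s with
  | zero => simp [PosRegular.defect_zero]
  | succ s ih =>
    rw [PosRegular.defect_succ]
    calc _ ≤ ‖f.defect X s Y‖ + C * ‖f.defect X s Y‖ :=
          (norm_sub_le _ _).trans (by gcongr; exact norm_phi_le h hC _)
      _ = (1 + C) * ‖f.defect X s Y‖ := by ring
      _ ≤ (1 + C) * ((1 + C) ^ s * ‖Y‖) := by gcongr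
      _ = _ := by ring

theorem tendsto_inner_defect_dilate (h : RowBounded f X C) (hC : 0 ≤ C) (s : ℕ)
    (Y : H →L[ℂ] H) (x : H) :
    Tendsto (fun r : ℝ => ⟪f.defect (dilate r X) s Y x, x⟫_ℂ) (𝓝[<] 1)
      (𝓝 ⟪f.defect X s Y x, x⟫_ℂ) := by
  have hr : ∀ᶠ r : ℝ in 𝓝[<] 1, r ∈ Set.Icc (0 : ℝ) 1 := by
    filter_upwards [Ioo_mem_nhdsLT (zero_lt_one' ℝ)] with r hr using ⟨hr.1.le, hr.2.le⟩
  induction s generalizing x with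
  | zero =>
    simp only [PosRegular.defect_zero]
    exact tendsto_const_nhds
  | succ s ih =>
    have h1 : ∀ᶠ r : ℝ in 𝓝[<] 1, ‖f.defect (NCVariety.dilate r X) s Y‖ ≤ (1 + C) ^ s * ‖Y‖ := by
      filter_upwards [hr] with r hr using norm_defect_le (h.dilate hr) hC s Y
    have h2 := tendsto_inner_phi_dilate h hC hr (tendsto_id.mono_left nhdsWithin_le_nhds) h1 ih x
    have h3 := (ih x).sub h2
    simp only [PosRegular.defect_succ, sub_apply, inner_sub_left]
    exact h3

/-- Since the empty word has coefficient 0, each contributing word has length at least 1 and picks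
up a factor at most r². All geometric decay comes from here. -/
theorem phi_dilate_le (h : RowBounded f X C) (hC : 0 ≤ C) {r : ℝ} (hr : r ∈ Set.Icc (0 : ℝ) 1)
    {D : H →L[ℂ] H} (hD : 0 ≤ D) :
    f.Phi (dilate r X) D ≤ ((r ^ 2 : ℝ) : ℂ) • f.Phi X D := by
  rw [← sub_nonneg, nonneg_iff_inner]
  intro x
  have h1 := (innerSLFlip ℂ x).hasSum (hasSum_phi (h.dilate hr) hC D x)
  have h2 := ((innerSLFlip ℂ x).hasSum (hasSum_phi h hC D x)).mul_left ((r ^ 2 : ℝ) : ℂ)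
  have h3 := h2.sub h1
  rw [sub_apply, inner_sub_left, smul_apply, inner_smul_left, Complex.conj_ofReal]
  refine h3.nonneg fun α => ?_
  rw [innerSLFlip_apply_apply, innerSLFlip_apply_apply, f.term_dilate, smul_apply,
    inner_smul_left, ← sub_mul, f.inner_term, ← mul_assoc]
  rcases α with _ | ⟨i, α⟩
  · simp [f.coeff_nil]
  · refine mul_nonneg (mul_nonneg ?_ (by exact_mod_cast f.nonneg _)) (nonneg_iff_inner.1 hD _)
    have : (r ^ 2) ^ (i :: α).length ≤ r ^ 2 :=
      pow_le_of_le_one (by positivity) (pow_le_one₀ hr.1 hr.2) (by simp)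
    simp only [map_pow, Complex.conj_ofReal]
    exact_mod_cast sub_nonneg.2 this

theorem smul_le_smul_of_le {c : ℝ} (hc : 0 ≤ c) {S T : H →L[ℂ] H} (hST : S ≤ T) :
    (c : ℂ) • S ≤ (c : ℂ) • T := by
  rw [← sub_nonneg, ← smul_sub, nonneg_iff_inner]
  intro x
  rw [smul_apply, inner_smul_left, Complex.conj_ofReal]
  exact mul_nonneg (by exact_mod_cast hc) (nonneg_iff_inner.1 (sub_nonneg.2 hST) x)

theorem iterate_phi_nonneg (h : RowBounded f X C) (hC : 0 ≤ C) {D : H →L[ℂ] H} (hD : 0 ≤ D)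
    (k : ℕ) : 0 ≤ (f.Phi X)^[k] D := by
  induction k with
  | zero => exact hD
  | succ k ih =>
    rw [Function.iterate_succ_apply']
    exact phi_nonneg h hC ih

theorem norm_iterate_phi_le (h : RowBounded f X C) (hC : 0 ≤ C) {q : ℝ} (hq : 0 ≤ q)
    {D : H →L[ℂ] H} (hD : 0 ≤ D) (hle : f.Phi X D ≤ (q : ℂ) • D) (k : ℕ) :
    ‖(f.Phi X)^[k] D‖ ≤ ‖D‖ * q ^ k := by
  have h1 : (f.Phi X)^[k] D ≤ ((q ^ k : ℝ) : ℂ) • D := by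
    induction k with
    | zero => simp
    | succ k ih =>
      rw [Function.iterate_succ_apply']
      refine (phi_mono h hC ih).trans ?_
      rw [phi_smul h hC]
      refine (smul_le_smul_of_le (by positivity) hle).trans_eq ?_
      rw [smul_smul, pow_succ]
      push_cast
      rfl
  refine (CStarAlgebra.norm_le_norm_of_nonneg_of_le (iterate_phi_nonneg h hC hD k) h1).trans ?_
  rw [norm_smul, Complex.norm_real, Real.norm_of_nonneg (by positivity), mul_comm]

end Dilation

/-! ### Iterated differences and summation by parts. -/

section Differences

variable {E : Type*} [NormedAddCommGroup E]

theorem hasSum_telescope {g : ℕ → E} (hg : Summable g) :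
    HasSum (fun k => g k - g (k + 1)) (g 0) := by
  have h1 := hg.hasSum
  have h2 := (hasSum_nat_add_iff' (f := g) 1).2 h1
  simpa using h1.sub h2

variable [NormedSpace ℂ E] [CompleteSpace E]

/-- The difference `x_k - x_{k+1}` of a sequence. -/
def seqDiff (x : ℕ → E) : ℕ → E := fun k => x k - x (k + 1)

theorem norm_iterate_seqDiff_le {q : ℝ} {x : ℕ → E} {M : ℝ}
    (hx : ∀ k, ‖x k‖ ≤ M * q ^ k) (s : ℕ) :
    ∃ M', ∀ k, ‖seqDiff^[s] x k‖ ≤ M' * q ^ k := by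
  induction s with
  | zero => exact ⟨M, hx⟩
  | succ s ih =>
    obtain ⟨M', h⟩ := ih
    refine ⟨M' + M' * q, fun k => ?_⟩
    rw [Function.iterate_succ_apply']
    calc _ ≤ M' * q ^ k + M' * q ^ (k + 1) := (norm_sub_le _ _).trans (add_le_add (h _) (h _))
      _ = _ := by ring

/-- Induction by Pascal's rule: with y the previous difference and g_k = C(k+s, s+1) y_k, the new
summand is C(k+s, s) y_k + (g_k - g_{k+1}). The second part telescopes to g_0 = 0. -/
theorem hasSum_choose_smul_seqDiff {q : ℝ} (hq : 0 ≤ q) (hq1 : q < 1) {x : ℕ → E} {M : ℝ}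
    (hx : ∀ k, ‖x k‖ ≤ M * q ^ k) (s : ℕ) :
    HasSum (fun k => (((k + s).choose s : ℕ) : ℂ) • seqDiff^[s + 1] x k) (x 0) := by
  induction s with
  | zero =>
    simp only [add_zero, Nat.choose_zero_right, Nat.cast_one, one_smul, zero_add,
      Function.iterate_one]
    exact hasSum_telescope (Summable.of_norm_bounded
      ((summable_geometric_of_lt_one hq hq1).mul_left M) hx)
  | succ s ih =>
    set y := seqDiff^[s + 1] x
    obtain ⟨M', hy⟩ := norm_iterate_seqDiff_le hx (s + 1)
    set g : ℕ → E := fun k => (((k + s).choose (s + 1) : ℕ) : ℂ) • y k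
    have hg : Summable g := by
      have h1 := summable_choose_mul_geometric_of_norm_lt_one (s + 1)
        (r := q) (by rwa [Real.norm_of_nonneg hq])
      refine Summable.of_norm_bounded (h1.mul_left M') fun k => ?_
      rw [norm_smul, Complex.norm_natCast]
      have h2 : ((k + s).choose (s + 1) : ℝ) ≤ ((k + (s + 1)).choose (s + 1) : ℝ) := by
        exact_mod_cast Nat.choose_le_choose _ (by omega)
      calc ((k + s).choose (s + 1) : ℝ) * ‖y k‖
          ≤ ((k + (s + 1)).choose (s + 1) : ℝ) * (M' * q ^ k) :=
            mul_le_mul h2 (hy k) (norm_nonneg _) (by positivity)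
        _ = _ := by ring
    have h0 : g 0 = 0 := by simp [g]
    have h3 := ih.add (hasSum_telescope hg)
    rw [h0, add_zero] at h3
    refine h3.congr_fun fun k => ?_
    rw [Function.iterate_succ_apply']
    change (((k + (s + 1)).choose (s + 1) : ℕ) : ℂ) • (y k - y (k + 1)) = _
    have h4 : (k + (s + 1)).choose (s + 1) = (k + s).choose s + (k + s).choose (s + 1) := by
      rw [← add_assoc, Nat.choose_succ_succ]
    have h5 : g (k + 1) = (((k + (s + 1)).choose (s + 1) : ℕ) : ℂ) • y (k + 1) := by
      simp only [g]
      rw [add_assoc, add_comm 1 s]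
    rw [h5, smul_sub, ← add_sub_assoc]
    congr 1
    rw [h4]
    push_cast
    rw [add_smul]

end Differences

/-! ### Recovering D from its defect of order m. -/

section Reproduction

variable {n : ℕ} {H : Type*} [NormedAddCommGroup H] [InnerProductSpace ℂ H] [CompleteSpace H]
  {f : PosRegular n} {X : Fin n → H →L[ℂ] H} {C : ℝ}

/-- Powers of Φ commute with id - Φ, and applying id - Φ to Φ^k(D) is taking one difference in k. -/
theorem iterate_phi_defect (h : RowBounded f X C) (hC : 0 ≤ C) (D : H →L[ℂ] H) (s : ℕ) :
    (fun k => (f.Phi X)^[k] (f.defect X s D)) = seqDiff^[s] fun k => (f.Phi X)^[k] D := by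
  induction s with
  | zero => rfl
  | succ s ih =>
    rw [Function.iterate_succ_apply', ← ih]
    ext1 k
    have h1 := (phiLin h hC ^ k).map_sub (f.defect X s D) (f.Phi X (f.defect X s D))
    simp only [Module.End.pow_apply] at h1
    rw [PosRegular.defect_succ, seqDiff, Function.iterate_succ_apply]
    exact h1

/-- The power series of (1 - z)^{-m} at Φ, undoing (id - Φ)^m. It is legitimate because the iterates
of Φ on D decay like q^k. -/
theorem hasSum_iterate_phi_defect (h : RowBounded f X C) (hC : 0 ≤ C) {q : ℝ} (hq : 0 ≤ q)
    (hq1 : q < 1) {D : H →L[ℂ] H} (hD : 0 ≤ D) (hle : f.Phi X D ≤ (q : ℂ) • D) {m : ℕ}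
    (hm : 1 ≤ m) :
    HasSum (fun k => (((k + (m - 1)).choose (m - 1) : ℕ) : ℂ) •
      (f.Phi X)^[k] (f.defect X m D)) D := by
  obtain ⟨s, rfl⟩ := Nat.exists_eq_add_of_le' hm
  have h1 := hasSum_choose_smul_seqDiff hq hq1 (norm_iterate_phi_le h hC hq hD hle) s
  rw [← iterate_phi_defect h hC] at h1
  exact h1

end Reproduction

open scoped ENNReal

/-! ### From iterates of Φ to the weights b_α, by counting factorizations of words. -/

section Factorizations

variable {n : ℕ}

/-- A list of nonempty words is the same as its concatenation together with the composition
recording the block lengths. Lists containing the empty word drop out by hypothesis. -/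
theorem tsum_factorizations (F : List (Word n) → ℝ≥0∞) (hF : ∀ L, [] ∈ L → F L = 0) :
    ∑' L, F L = ∑' α : Word n, ∑ c : Composition α.length, F (α.splitWrtComposition c) := by
  let g : (Σ α : Word n, Composition α.length) → List (Word n) :=
    fun p => p.1.splitWrtComposition p.2
  have hg : Function.Injective g := by
    rintro ⟨α, c⟩ ⟨β, d⟩ hcd
    have h1 : α = β := by
      have := congrArg List.flatten hcd
      simpa [g, List.flatten_splitWrtComposition] using this
    subst h1
    have h2 : c = d := by
      have := congrArg (List.map List.length) hcd
      simp only [g, List.map_length_splitWrtComposition] at this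
      exact Composition.ext this
    rw [h2]
  have hsupp : Function.support F ⊆ Set.range g := by
    intro L hL
    have hne : [] ∉ L := fun h => hL (hF L h)
    let c : Composition L.flatten.length :=
      ⟨L.map List.length, fun {i} hi => by
        obtain ⟨w, hw, rfl⟩ := List.mem_map.1 hi
        exact List.length_pos_iff.2 fun h => hne (h ▸ hw), by simp [List.length_flatten]⟩
    exact ⟨⟨L.flatten, c⟩, List.splitWrtComposition_flatten L c rfl⟩
  rw [← hg.tsum_eq hsupp, ENNReal.tsum_sigma']
  exact tsum_congr fun α => by rw [tsum_fintype]

theorem tsum_list (F : List (Word n) → ℝ≥0∞) :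
    ∑' L, F L = ∑' (k : ℕ) (L : List.Vector (Word n) k), F L.toList := by
  rw [← ENNReal.tsum_sigma' (fun p : Σ k, List.Vector (Word n) k => F p.2.toList)]
  exact ((Equiv.sigmaFiberEquiv (List.length (α := Word n))).tsum_eq F).symm

theorem tsum_vector_succ (k : ℕ) (F : List (Word n) → ℝ≥0∞) :
    ∑' L : List.Vector (Word n) (k + 1), F L.toList =
      ∑' (γ : Word n) (L : List.Vector (Word n) k), F (γ :: L.toList) := by
  rw [← ENNReal.tsum_prod (f := fun (γ : Word n) (L : List.Vector (Word n) k) => F (γ :: L.toList))]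
  let e : Word n × List.Vector (Word n) k ≃ List.Vector (Word n) (k + 1) :=
    { toFun := fun p => p.1 ::ᵥ p.2
      invFun := fun L => (L.head, L.tail)
      left_inv := fun p => by simp
      right_inv := fun L => by simp }
  rw [← e.tsum_eq]
  exact tsum_congr fun p => by simp [e]

variable {H : Type*} [NormedAddCommGroup H] [InnerProductSpace ℂ H] [CompleteSpace H]
  {f : PosRegular n} {X : Fin n → H →L[ℂ] H} {C : ℝ}

/-- `⟨X_α R X_α^* x, x⟩`. -/
def conjForm (X : Fin n → H →L[ℂ] H) (R : H →L[ℂ] H) (x : H) (α : Word n) : ℝ :=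
  (⟪R (star (wordProd X α) x), star (wordProd X α) x⟫_ℂ).re

theorem re_inner_nonneg {R : H →L[ℂ] H} (hR : 0 ≤ R) (x : H) : 0 ≤ (⟪R x, x⟫_ℂ).re :=
  (Complex.nonneg_iff.1 (nonneg_iff_inner.1 hR x)).1

theorem conjForm_append (R : H →L[ℂ] H) (x : H) (α β : Word n) :
    conjForm X R (star (wordProd X α) x) β = conjForm X R x (α ++ β) := by
  rw [conjForm, conjForm, wordProd_append, star_mul]
  rfl

theorem prod_coeff_nonneg (L : List (Word n)) : 0 ≤ (L.map f.coeff).prod := by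
  refine List.prod_nonneg fun x hx => ?_
  obtain ⟨γ, _, rfl⟩ := List.mem_map.1 hx
  exact f.nonneg γ

theorem ofReal_iterate_phi (h : RowBounded f X C) (hC : 0 ≤ C) {R : H →L[ℂ] H} (hR : 0 ≤ R)
    (k : ℕ) (x : H) :
    ENNReal.ofReal (⟪(f.Phi X)^[k] R x, x⟫_ℂ).re =
      ∑' L : List.Vector (Word n) k,
        ENNReal.ofReal ((L.toList.map f.coeff).prod * conjForm X R x L.toList.flatten) := by
  induction k generalizing x with
  | zero =>
    rw [tsum_eq_single List.Vector.nil fun L hL => absurd (Subsingleton.elim _ _) hL]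
    simp [conjForm]
  | succ k ih =>
    rw [tsum_vector_succ k fun L =>
      ENNReal.ofReal ((L.map f.coeff).prod * conjForm X R x L.flatten)]
    rw [Function.iterate_succ_apply']
    have h1 := Complex.hasSum_re (hasSum_inner_phi h hC ((f.Phi X)^[k] R) x x)
    simp only [Complex.re_ofReal_mul] at h1
    have h2 := iterate_phi_nonneg h hC hR k
    rw [← h1.tsum_eq, ENNReal.ofReal_tsum_of_nonneg
      (fun γ => mul_nonneg (f.nonneg γ) (re_inner_nonneg h2 _)) h1.summable]
    refine tsum_congr fun γ => ?_
    rw [ENNReal.ofReal_mul (f.nonneg γ), ih, ← ENNReal.tsum_mul_left]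
    refine tsum_congr fun L => ?_
    rw [← ENNReal.ofReal_mul (f.nonneg γ), conjForm_append, List.map_cons, List.prod_cons,
      List.flatten_cons, mul_assoc]

/-- Φ^k(R) expands over lists of k words, and collecting lists by their concatenation α produces
exactly b_α. All summands are nonnegative, so the regrouping is free in `ℝ≥0∞`, and finiteness of
the total brings it back to the reals. -/
theorem hasSum_weight_conjForm (h : RowBounded f X C) (hC : 0 ≤ C) {R D : H →L[ℂ] H}
    (hR : 0 ≤ R) {m : ℕ}
    (hD : HasSum (fun k => (((k + (m - 1)).choose (m - 1) : ℕ) : ℂ) • (f.Phi X)^[k] R) D)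
    (x : H) : HasSum (fun α => f.weight m α * conjForm X R x α) (⟪D x, x⟫_ℂ).re := by
  have hc : ∀ y α, 0 ≤ conjForm X R y α := fun y α => re_inner_nonneg hR _
  have h1 := Complex.hasSum_re
    ((innerSLFlip ℂ x).hasSum (hD.mapL (ContinuousLinearMap.apply ℂ H x)))
  have h1' : HasSum (fun k => ((k + (m - 1)).choose (m - 1) : ℝ) * (⟪(f.Phi X)^[k] R x, x⟫_ℂ).re)
      (⟪D x, x⟫_ℂ).re := by
    refine h1.congr_fun fun k => ?_
    simp
  have hnn : ∀ k, 0 ≤ (⟪(f.Phi X)^[k] R x, x⟫_ℂ).re := fun k =>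
    re_inner_nonneg (iterate_phi_nonneg h hC hR k) x
  have hD0 : 0 ≤ (⟪D x, x⟫_ℂ).re := h1'.nonneg fun k => by have := hnn k; positivity
  set F : List (Word n) → ℝ≥0∞ := fun L => ENNReal.ofReal
    (((L.length + (m - 1)).choose (m - 1) : ℝ) *
      ((L.map f.coeff).prod * conjForm X R x L.flatten))
  have h2 : ENNReal.ofReal (⟪D x, x⟫_ℂ).re = ∑' L, F L := by
    rw [← h1'.tsum_eq, ENNReal.ofReal_tsum_of_nonneg
      (fun k => by have := hnn k; positivity) h1'.summable, tsum_list]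
    refine tsum_congr fun k => ?_
    rw [ENNReal.ofReal_mul (by positivity), ofReal_iterate_phi h hC hR, ← ENNReal.tsum_mul_left]
    refine tsum_congr fun L => ?_
    rw [← ENNReal.ofReal_mul (by positivity)]
    simp [F]
  have h3 : ∑' L, F L = ∑' α, ENNReal.ofReal (f.weight m α * conjForm X R x α) := by
    rw [tsum_factorizations F]
    · refine tsum_congr fun α => ?_
      rw [PosRegular.weight, Finset.sum_mul, ENNReal.ofReal_sum_of_nonneg]
      · refine Finset.sum_congr rfl fun c _ => ?_
        simp only [F, List.flatten_splitWrtComposition, List.length_splitWrtComposition]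
        congr 1
        ring
      · intro c _
        exact mul_nonneg (mul_nonneg (prod_coeff_nonneg _) (by positivity)) (hc _ _)
    · intro L hL
      have : (L.map f.coeff).prod = 0 :=
        List.prod_eq_zero (List.mem_map.2 ⟨[], hL, f.coeff_nil⟩)
      simp [F, this]
  have hnn' : ∀ α, 0 ≤ f.weight m α * conjForm X R x α := fun α =>
    mul_nonneg (f.weight_nonneg m α) (hc x α)
  have h4 : HasSum (fun α => ENNReal.ofReal (f.weight m α * conjForm X R x α))
      (ENNReal.ofReal (⟪D x, x⟫_ℂ).re) := by
    rw [h2, h3]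
    exact ENNReal.summable.hasSum
  have h5 := ENNReal.hasSum_toReal (f := fun α => ENNReal.ofReal (f.weight m α * conjForm X R x α))
    (by rw [h4.tsum_eq]; exact ENNReal.ofReal_ne_top)
  rw [← ENNReal.tsum_toReal_eq fun _ => ENNReal.ofReal_ne_top, h4.tsum_eq,
    ENNReal.toReal_ofReal hD0] at h5
  exact h5.congr_fun fun α => (ENNReal.toReal_ofReal (hnn' α)).symm

end Factorizations

/-! ### Invariance of N_P under the adjoints W_i^*. -/

section Model

variable {n : ℕ} {f : PosRegular n} {m : ℕ} {P : Set (FreeAlgebra ℂ (Fin n))}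

theorem W_mem_MSpace (i : Fin n) {x : Fock n} (hx : x ∈ MSpace f m P) :
    f.W m i x ∈ MSpace f m P := by
  have h : MSpace f m P ≤ (MSpace f m P).comap (f.W m i).toLinearMap := by
    refine Submodule.topologicalClosure_minimal _ ?_
      ((Submodule.isClosed_topologicalClosure _).preimage (f.W m i).continuous)
    rw [Submodule.span_le]
    rintro _ ⟨p, hp, α, β, rfl⟩
    refine Submodule.le_topologicalClosure _ (Submodule.subset_span ⟨p, hp, i :: α, β, ?_⟩)
    rw [wordProd_cons]
    rfl
  exact h hx

theorem star_W_mem_NSpace (i : Fin n) {x : Fock n} (hx : x ∈ NSpace f m P) :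
    star (f.W m i) x ∈ NSpace f m P := by
  rw [NSpace, Submodule.mem_orthogonal] at hx ⊢
  intro u hu
  rw [ContinuousLinearMap.star_eq_adjoint, ContinuousLinearMap.adjoint_inner_right]
  exact hx _ (W_mem_MSpace i hu)

theorem star_BModel (i : Fin n) :
    star (BModel f m P i) = PN f m P ∘L star (f.W m i) ∘L (NSpace f m P).subtypeL := by
  simp only [BModel, PN, ContinuousLinearMap.star_eq_adjoint, ContinuousLinearMap.adjoint_comp,
    Submodule.adjoint_subtypeL, Submodule.adjoint_orthogonalProjectionOnto]
  rfl

/-- M_P is W_i-invariant, so W_i^* preserves its orthocomplement and the compressing projection has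
no effect. -/
theorem coe_star_BModel (i : Fin n) (x : NSpace f m P) :
    ((star (BModel f m P i) x : NSpace f m P) : Fock n) = star (f.W m i) (x : Fock n) := by
  rw [star_BModel]
  exact congrArg Subtype.val ((NSpace f m P).orthogonalProjectionOnto_mem_subspace_eq_self
    ⟨_, star_W_mem_NSpace i x.2⟩)

end Model

/-! ### Compression to a coinvariant subspace. -/

section Coinvariant

variable {n : ℕ} {f : PosRegular n} {E F : Type*}
  [NormedAddCommGroup E] [InnerProductSpace ℂ E] [CompleteSpace E]
  [NormedAddCommGroup F] [InnerProductSpace ℂ F] [CompleteSpace F]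
  {B : Fin n → E →L[ℂ] E} {W : Fin n → F →L[ℂ] F} {J : E →ₗᵢ[ℂ] F}

theorem map_star_wordProd (hJ : ∀ i x, J (star (B i) x) = star (W i) (J x)) (α : Word n) (x : E) :
    J (star (wordProd B α) x) = star (wordProd W α) (J x) := by
  induction α generalizing x with
  | nil => simp
  | cons i α ih =>
    rw [wordProd_cons, wordProd_cons, star_mul, star_mul, mul_apply_eq_comp, mul_apply_eq_comp,
      ih, hJ]

theorem RowBounded.coinvariant (hJ : ∀ i x, J (star (B i) x) = star (W i) (J x)) {C : ℝ}
    (h : RowBounded f W C) : RowBounded f B C := fun s x => by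
  have h1 := h s (J x)
  rw [J.norm_map] at h1
  refine le_trans (le_of_eq (Finset.sum_congr rfl fun α _ => ?_)) h1
  rw [PosRegular.sqTerm, PosRegular.sqTerm, ← map_star_wordProd hJ, J.norm_map]

/-- In a sesquilinear form Φ sees the tuple only through the adjoint words, and J intertwines those.
Induction on s then identifies the defect of rB with the compression of that of rW. -/
theorem inner_defect_dilate_coinvariant (hJ : ∀ i x, J (star (B i) x) = star (W i) (J x)) {C : ℝ}
    (h : RowBounded f W C) (hC : 0 ≤ C) {r : ℝ} (hr : r ∈ Set.Icc (0 : ℝ) 1) (s : ℕ) (x y : E) :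
    ⟪f.defect (dilate r B) s 1 x, y⟫_ℂ = ⟪f.defect (dilate r W) s 1 (J x), J y⟫_ℂ := by
  induction s generalizing x y with
  | zero => exact (J.inner_map_map x y).symm
  | succ s ih =>
    rw [PosRegular.defect_succ, PosRegular.defect_succ, sub_apply, sub_apply, inner_sub_left,
      inner_sub_left, ih]
    congr 1
    refine (hasSum_inner_phi ((h.coinvariant hJ).dilate hr) hC _ x y).unique
      ((hasSum_inner_phi (h.dilate hr) hC _ (J x) (J y)).congr_fun fun α => ?_)
    rw [ih]
    simp only [star_wordProd_dilate, smul_apply, map_smul, map_star_wordProd hJ]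

end Coinvariant

/-! ### The operator system spanned by the B_α B_β^*. -/

section OperatorSystem

variable {n : ℕ} {E : Type*} [NormedAddCommGroup E] [InnerProductSpace ℂ E] [CompleteSpace E]
  {B : Fin n → E →L[ℂ] E}

/-- `B_α B_β^*`. -/
def wordPair (B : Fin n → E →L[ℂ] E) (α β : Word n) : E →L[ℂ] E :=
  wordProd B α * star (wordProd B β)

/-- The norm-closed span of the operators `B_α B_β^*`. -/
def pairSystem (B : Fin n → E →L[ℂ] E) : Submodule ℂ (E →L[ℂ] E) :=
  (Submodule.span ℂ {T | ∃ α β : Word n, T = wordPair B α β}).topologicalClosure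

theorem wordPair_mem (α β : Word n) : wordPair B α β ∈ pairSystem B :=
  Submodule.le_topologicalClosure _ (Submodule.subset_span ⟨α, β, rfl⟩)

theorem one_mem_pairSystem : 1 ∈ pairSystem B := by
  simpa [wordPair] using wordPair_mem (B := B) [] []

theorem isClosed_pairSystem : IsClosed (pairSystem B : Set (E →L[ℂ] E)) :=
  Submodule.isClosed_topologicalClosure _

/-- `B_α B_β^*` as an element of the operator system. -/
def pairElem (B : Fin n → E →L[ℂ] E) (α β : Word n) : pairSystem B :=
  ⟨wordPair B α β, wordPair_mem α β⟩

/-- The identity as an element of the operator system. -/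
def pairOne (B : Fin n → E →L[ℂ] E) : pairSystem B := ⟨1, one_mem_pairSystem⟩

/-- The submodule `q` repackages `p`: linear combinations are handled by `q`, limits by `hc`. -/
theorem pairSystem_induction {p : (E →L[ℂ] E) → Prop} {q : Submodule ℂ (E →L[ℂ] E)}
    (hq : ∀ T, T ∈ q ↔ p T) (hc : IsClosed {T | p T}) (hp : ∀ α β, p (wordPair B α β))
    {T : E →L[ℂ] E} (hT : T ∈ pairSystem B) : p T := by
  have h : pairSystem B ≤ q := by
    refine Submodule.topologicalClosure_minimal _ ?_ ?_
    · rw [Submodule.span_le]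
      rintro _ ⟨α, β, rfl⟩
      exact (hq _).2 (hp α β)
    · convert hc using 1
      ext T
      exact hq T
  exact (hq T).1 (h hT)

theorem star_mem_pairSystem {T : E →L[ℂ] E} (hT : T ∈ pairSystem B) : star T ∈ pairSystem B := by
  refine pairSystem_induction (p := fun T => star T ∈ pairSystem B)
    (q := { carrier := {T | star T ∈ pairSystem B}
            add_mem' := fun {S T} hS hT => by
              simpa only [Set.mem_ofPred_eq, star_add] using Submodule.add_mem _ hS hT
            zero_mem' := by simp
            smul_mem' := fun c T hT => by
              simpa only [Set.mem_ofPred_eq, star_smul] using Submodule.smul_mem _ _ hT })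
    (fun _ => Iff.rfl) (isClosed_pairSystem.preimage continuous_star) (fun α β => ?_) hT
  have h : star (wordPair B α β) = wordPair B β α := by rw [wordPair, wordPair, star_mul, star_star]
  rw [h]
  exact wordPair_mem β α

theorem conj_wordPair (α β γ : Word n) :
    wordProd B γ * wordPair B α β * star (wordProd B γ) = wordPair B (γ ++ α) (γ ++ β) := by
  simp only [wordPair, wordProd_append, star_mul, mul_assoc]

/-- The closed span need not be an algebra, but conjugation by B_γ merely prefixes both words by γ,
and this is all that Φ requires. -/
theorem conj_mem_pairSystem (γ : Word n) {T : E →L[ℂ] E} (hT : T ∈ pairSystem B) :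
    wordProd B γ * T * star (wordProd B γ) ∈ pairSystem B := by
  let c : (E →L[ℂ] E) →ₗ[ℂ] (E →L[ℂ] E) :=
    LinearMap.mulRight ℂ (star (wordProd B γ)) ∘ₗ LinearMap.mulLeft ℂ (wordProd B γ)
  refine pairSystem_induction (p := fun T => wordProd B γ * T * star (wordProd B γ) ∈ pairSystem B)
    (q := (pairSystem B).comap c) (fun _ => Iff.rfl)
    (isClosed_pairSystem.preimage (by fun_prop)) (fun α β => ?_) hT
  rw [conj_wordPair]
  exact wordPair_mem _ _

theorem dense_span_pairElem :
    Dense (Submodule.span ℂ (Set.range fun p : Word n × Word n => pairElem B p.1 p.2) :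
      Set (pairSystem B)) := by
  intro T
  rw [Topology.IsInducing.subtypeVal.closure_eq_preimage_closure_image, Set.mem_preimage]
  have h1 : Subtype.val '' (Submodule.span ℂ
      (Set.range fun p : Word n × Word n => pairElem B p.1 p.2) : Set (pairSystem B)) =
      (Submodule.span ℂ {T | ∃ α β : Word n, T = wordPair B α β} : Set _) := by
    have h2 := Submodule.map_coe (pairSystem B).subtype (Submodule.span ℂ
      (Set.range fun p : Word n × Word n => pairElem B p.1 p.2))
    rw [Submodule.map_span] at h2
    refine h2.symm.trans ?_
    congr 2
    ext T
    constructor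
    · rintro ⟨_, ⟨p, rfl⟩, rfl⟩
      exact ⟨p.1, p.2, rfl⟩
    · rintro ⟨α, β, rfl⟩
      exact ⟨_, ⟨(α, β), rfl⟩, rfl⟩
  have h3 : (T : E →L[ℂ] E) ∈
      closure (Submodule.span ℂ {T | ∃ α β : Word n, T = wordPair B α β} : Set _) := T.2
  rwa [← h1] at h3

theorem clm_ext_pairElem {G : Type*} [NormedAddCommGroup G] [NormedSpace ℂ G]
    {φ ψ : pairSystem B →L[ℂ] G} (h : ∀ α β, φ (pairElem B α β) = ψ (pairElem B α β)) :
    φ = ψ :=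
  ContinuousLinearMap.ext_on dense_span_pairElem (by rintro _ ⟨p, rfl⟩; exact h _ _)

end OperatorSystem

/-! ### Completely positive maps: boundedness, intertwining with Φ, the cone. -/

section CompletelyPositive

variable {n : ℕ} {f : PosRegular n} {m : ℕ}
  {E : Type*} [NormedAddCommGroup E] [InnerProductSpace ℂ E] [CompleteSpace E]
  {H : Type*} [NormedAddCommGroup H] [InnerProductSpace ℂ H] [CompleteSpace H]
  {B : Fin n → E →L[ℂ] E} {φ : pairSystem B →ₗ[ℂ] (H →L[ℂ] H)}

theorem nonneg_iff_inner_right {T : E →L[ℂ] E} : 0 ≤ T ↔ ∀ x, 0 ≤ ⟪x, T x⟫_ℂ := by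
  rw [nonneg_iff_inner]
  refine forall_congr' fun x => ?_
  rw [← inner_conj_symm x, ← star_nonneg_iff]
  rfl

theorem IsCP.nonneg (hφ : IsCP φ) {T : pairSystem B}
    (hT : (0 : E →L[ℂ] E) ≤ T) : 0 ≤ φ T := by
  rw [nonneg_iff_inner_right] at hT ⊢
  intro x
  simpa using hφ 1 (fun _ _ => T) (fun h => by simpa using hT (h 0)) fun _ => x

/-- Positivity applied to 0 ≤ ‖T‖ I + T ≤ 2‖T‖ I. Subtracting φ(‖T‖ I) gives the constant 2 + 1 = 3,
which is not sharp; only continuity of φ is wanted. -/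
theorem IsCP.norm_le_of_isSelfAdjoint (hφ : IsCP φ) {T : pairSystem B}
    (hT : IsSelfAdjoint (T : E →L[ℂ] E)) :
    ‖φ T‖ ≤ 3 * ‖φ (pairOne B)‖ * ‖T‖ := by
  have h1 := IsSelfAdjoint.le_algebraMap_norm_self (ha := hT)
  have h2 := IsSelfAdjoint.neg_algebraMap_norm_le_self (ha := hT)
  have h3 : (algebraMap ℝ (E →L[ℂ] E)) ‖(T : E →L[ℂ] E)‖ =
      (((‖T‖ : ℂ) • pairOne B : pairSystem B) : E →L[ℂ] _) := by
    rw [Algebra.algebraMap_eq_smul_one]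
    ext x
    simp [pairOne]
  rw [h3] at h1 h2
  set c : pairSystem B := (‖T‖ : ℂ) • pairOne B
  have h4 : 0 ≤ φ (c + T) := hφ.nonneg (by
    rw [Submodule.coe_add]
    exact neg_le_iff_add_nonneg'.1 h2)
  have h5 : φ (c + T) ≤ φ (c + c) := by
    rw [← sub_nonneg, ← map_sub]
    refine hφ.nonneg ?_
    rw [add_sub_add_left_eq_sub, Submodule.coe_sub]
    exact sub_nonneg.2 h1
  have h6 := CStarAlgebra.norm_le_norm_of_nonneg_of_le h4 h5
  have h7 : ‖φ c‖ = ‖T‖ * ‖φ (pairOne B)‖ := by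
    simp [c, norm_smul]
  calc ‖φ T‖ = ‖φ (c + T) - φ c‖ := by rw [map_add, add_sub_cancel_left]
    _ ≤ ‖φ (c + T)‖ + ‖φ c‖ := norm_sub_le _ _
    _ ≤ ‖φ c + φ c‖ + ‖φ c‖ := by rw [← map_add]; gcongr
    _ ≤ ‖φ c‖ + ‖φ c‖ + ‖φ c‖ := by gcongr; exact norm_add_le _ _
    _ = _ := by rw [h7]; ring

theorem IsCP.norm_le (hφ : IsCP φ) (T : pairSystem B) :
    ‖φ T‖ ≤ 6 * ‖φ (pairOne B)‖ * ‖T‖ := by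
  set S : pairSystem B := ⟨star (T : E →L[ℂ] E), star_mem_pairSystem T.2⟩
  have hS : ‖S‖ = ‖T‖ := norm_star (T : E →L[ℂ] E)
  set U := T + S
  set V := Complex.I • (T - S)
  have hU : IsSelfAdjoint (U : E →L[ℂ] E) := by
    simp only [U, S, Submodule.coe_add]
    exact IsSelfAdjoint.add_star_self _
  have hV : IsSelfAdjoint (V : E →L[ℂ] E) := by
    simp only [V, S, Submodule.coe_smul, Submodule.coe_sub, IsSelfAdjoint, star_smul, star_sub,
      star_star]
    rw [← neg_sub, smul_neg, ← neg_smul]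
    simp
  have h1 := hφ.norm_le_of_isSelfAdjoint hU
  have h2 := hφ.norm_le_of_isSelfAdjoint hV
  have hU' : ‖U‖ ≤ 2 * ‖T‖ := (norm_add_le _ _).trans_eq (by rw [hS]; ring)
  have hV' : ‖V‖ ≤ 2 * ‖T‖ := by
    rw [norm_smul, Complex.norm_I, one_mul]
    exact (norm_sub_le _ _).trans_eq (by rw [hS]; ring)
  have h3 : T = (2⁻¹ : ℂ) • (U - Complex.I • V) := by
    simp only [U, V, smul_smul, Complex.I_mul_I]
    module
  have h4 : 0 ≤ ‖φ (pairOne B)‖ := norm_nonneg _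
  calc ‖φ T‖ = ‖(2⁻¹ : ℂ) • (φ U - Complex.I • φ V)‖ := by
        conv_lhs => rw [h3]
        simp
    _ ≤ 2⁻¹ * (‖φ U‖ + ‖φ V‖) := by
        rw [norm_smul]
        simp only [norm_inv, Complex.norm_ofNat]
        gcongr
        refine (norm_sub_le _ _).trans_eq ?_
        rw [norm_smul, Complex.norm_I, one_mul]
    _ ≤ 2⁻¹ * (3 * ‖φ (pairOne B)‖ * (2 * ‖T‖) + 3 * ‖φ (pairOne B)‖ * (2 * ‖T‖)) := by
        gcongr
        · exact h1.trans (by gcongr)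
        · exact h2.trans (by gcongr)
    _ = _ := by ring

/-- A completely positive map on the operator system, as a bounded operator. -/
def IsCP.toCLM (hφ : IsCP φ) : pairSystem B →L[ℂ] (H →L[ℂ] H) :=
  φ.mkContinuous _ hφ.norm_le

/-- The completely positive maps `φ` with `φ(B_α B_β^*) = A_α φ(I) A_β^*`. -/
def pairMaps (B : Fin n → E →L[ℂ] E) (A : Fin n → H →L[ℂ] H) :
    Set (pairSystem B →ₗ[ℂ] (H →L[ℂ] H)) :=
  {φ | IsCP φ ∧ ∀ α β : Word n,
    φ (pairElem B α β) = wordProd A α * φ (pairOne B) * star (wordProd A β)}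

variable {A : Fin n → H →L[ℂ] H}

/-- Both sides are continuous in T and agree on the generators, where prefixing by γ turns A_α into
A_γ A_α. -/
theorem pairMaps.map_conj (hφ : φ ∈ pairMaps B A) (γ : Word n) (T : pairSystem B) :
    φ ⟨_, conj_mem_pairSystem γ T.2⟩ = wordProd A γ * φ T * star (wordProd A γ) := by
  let c : pairSystem B →ₗ[ℂ] pairSystem B :=
    { toFun := fun T => ⟨_, conj_mem_pairSystem γ T.2⟩
      map_add' := fun S T => Subtype.ext (by simp [mul_add, add_mul])
      map_smul' := fun a T => Subtype.ext (by simp) }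
  have hc : Continuous c := by
    refine Continuous.subtype_mk ?_ _
    fun_prop
  let ψ : pairSystem B →L[ℂ] (H →L[ℂ] H) := hφ.1.toCLM.comp ⟨c, hc⟩
  let χ : pairSystem B →L[ℂ] (H →L[ℂ] H) :=
    ((ContinuousLinearMap.mul ℂ (H →L[ℂ] H)).flip (star (wordProd A γ))).comp
      ((ContinuousLinearMap.mul ℂ (H →L[ℂ] H) (wordProd A γ)).comp hφ.1.toCLM)
  have h : ψ = χ := by
    refine clm_ext_pairElem fun α β => ?_
    have h1 : c (pairElem B α β) = pairElem B (γ ++ α) (γ ++ β) :=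
      Subtype.ext (conj_wordPair α β γ)
    change φ (c (pairElem B α β)) = wordProd A γ * φ (pairElem B α β) * star (wordProd A γ)
    rw [h1, hφ.2, hφ.2]
    simp only [wordProd_append, star_mul, mul_assoc]
  exact congrArg (fun g : pairSystem B →L[ℂ] (H →L[ℂ] H) => g T) h

/-- For r < 1 the series converges in norm, so its sum lies in the system and the bounded map φ
passes through it term by term. -/
theorem pairMaps.map_phi (hφ : φ ∈ pairMaps B A) {C : ℝ} (hC : 0 ≤ C)
    (hB : RowBounded f B C) (hA : RowBounded f A C) {r : ℝ}
    (hr : r ∈ Set.Ico (0 : ℝ) 1) (T : pairSystem B) :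
    ∃ h : f.Phi (dilate r B) T ∈ pairSystem B,
      φ ⟨_, h⟩ = f.Phi (dilate r A) (φ T) := by
  have h1 := hasSum_phi_dilate hB hC hr (T : E →L[ℂ] E)
  have h2 : ∀ α, f.term (dilate r B) T α ∈ pairSystem B := by
    intro α
    rw [f.term_dilate]
    exact Submodule.smul_mem _ _ (Submodule.smul_mem _ _ (conj_mem_pairSystem α T.2))
  have h3 : f.Phi (dilate r B) T ∈ pairSystem B :=
    (isClosed_pairSystem).mem_of_tendsto h1
      (Eventually.of_forall fun s => Submodule.sum_mem _ fun α _ => h2 α)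
  refine ⟨h3, ?_⟩
  have h4 : HasSum (fun α => (⟨_, h2 α⟩ : pairSystem B)) ⟨_, h3⟩ :=
    (Topology.IsInducing.subtypeVal.hasSum_iff (g := (pairSystem B).subtype) _ _).1 h1
  have h5 := hφ.1.toCLM.hasSum h4
  refine h5.unique ((hasSum_phi_dilate hA hC hr (φ T)).congr_fun fun α => ?_)
  have h6 : (⟨_, h2 α⟩ : pairSystem B) =
      ((r : ℂ) ^ 2) ^ α.length • (f.coeff α : ℂ) • ⟨_, conj_mem_pairSystem α T.2⟩ :=
    Subtype.ext (f.term_dilate r _ α)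
  change φ _ = _
  rw [h6, map_smul, map_smul, pairMaps.map_conj hφ, f.term_dilate]
  rfl

theorem pairMaps.map_defect (hφ : φ ∈ pairMaps B A) {C : ℝ} (hC : 0 ≤ C)
    (hB : RowBounded f B C) (hA : RowBounded f A C) {r : ℝ}
    (hr : r ∈ Set.Ico (0 : ℝ) 1) (s : ℕ) :
    ∃ h : f.defect (dilate r B) s 1 ∈ pairSystem B,
      φ ⟨_, h⟩ = f.defect (dilate r A) s (φ (pairOne B)) := by
  induction s with
  | zero => exact ⟨one_mem_pairSystem, rfl⟩
  | succ s ih =>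
    obtain ⟨h1, h2⟩ := ih
    obtain ⟨h3, h4⟩ := pairMaps.map_phi hφ hC hB hA hr ⟨_, h1⟩
    refine ⟨by rw [PosRegular.defect_succ]; exact Submodule.sub_mem _ h1 h3, ?_⟩
    rw [PosRegular.defect_succ s (φ (pairOne B)), ← h2, ← h4, ← map_sub]
    congr 1
    exact Subtype.ext (f.defect_succ s _)

theorem pairMaps.ext {ψ : pairSystem B →ₗ[ℂ] (H →L[ℂ] H)} (hφ : φ ∈ pairMaps B A)
    (hψ : ψ ∈ pairMaps B A) (h : φ (pairOne B) = ψ (pairOne B)) : φ = ψ := by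
  have h1 : hφ.1.toCLM = hψ.1.toCLM := clm_ext_pairElem fun α β => by
    change φ _ = ψ _
    rw [hφ.2, hψ.2, h]
  exact LinearMap.ext fun T => congrArg (fun g : pairSystem B →L[ℂ] (H →L[ℂ] H) => g T) h1

theorem dilate_one (A : Fin n → H →L[ℂ] H) : dilate 1 A = A := by
  ext i
  simp [dilate]

/-- For r < 1 the defects of φ(I) along rA are images of positive defects along rB. At r = 1, where
norm convergence may fail, positivity survives as a limit of quadratic forms. -/
theorem pairMaps.map_one_mem_coneRad (hφ : φ ∈ pairMaps B A) {C : ℝ} (hC : 0 ≤ C)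
    (hB : RowBounded f B C) (hA : RowBounded f A C) {δ : ℝ} (hδ : δ ∈ Set.Ioo (0 : ℝ) 1)
    (hpos : ∀ r ∈ Set.Ioo δ 1, ∀ s ∈ Finset.Icc 1 m, 0 ≤ f.defect (dilate r B) s 1) :
    φ (pairOne B) ∈ f.coneRad m A := by
  have hD : 0 ≤ φ (pairOne B) := hφ.1.nonneg (by
    change (0 : E →L[ℂ] E) ≤ 1
    exact zero_le_one)
  have h1 : ∀ r ∈ Set.Ioo δ 1, ∀ s ∈ Finset.Icc 1 m,
      0 ≤ f.defect (dilate r A) s (φ (pairOne B)) := by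
    intro r hr s hs
    obtain ⟨h2, h3⟩ := pairMaps.map_defect hφ hC hB hA ⟨(hδ.1.trans hr.1).le, hr.2⟩ s
    rw [← h3]
    exact hφ.1.nonneg (hpos r hr s hs)
  have h2 : ∀ s ∈ Finset.Icc 1 m, 0 ≤ f.defect A s (φ (pairOne B)) := by
    intro s hs
    rw [nonneg_iff_inner]
    intro x
    refine ge_of_tendsto (tendsto_inner_defect_dilate hA hC s _ x) ?_
    filter_upwards [Ioo_mem_nhdsLT hδ.2] with r hr
    exact nonneg_iff_inner.1 (h1 r hr s hs) x
  refine ⟨⟨hD, h2⟩, δ, hδ, fun r hr => ⟨hD, ?_⟩⟩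
  rcases hr.2.eq_or_lt with h | h
  · rw [h, dilate_one]
    exact h2
  · exact h1 r ⟨hr.1, h⟩

end CompletelyPositive

/-! ### Specialization to the universal model of the variety. -/

section Model

variable {n : ℕ} {f : PosRegular n} {m : ℕ} {P : Set (FreeAlgebra ℂ (Fin n))}
  {H : Type*} [NormedAddCommGroup H] [InnerProductSpace ℂ H] [CompleteSpace H]
  {A : Fin n → H →L[ℂ] H} {φ : OpSystem f m P →ₗ[ℂ] (H →L[ℂ] H)}

theorem CPMaps.map_one_mem_coneRad (hf : f.IsRadial m) (hA : SOTSummable f A)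
    (hφ : φ ∈ CPMaps f m P A) : φ (opOne f m P) ∈ f.coneRad m A := by
  obtain ⟨TA, hTA⟩ := hA
  obtain ⟨δ, hδ, hrad⟩ := hf
  obtain ⟨⟨TW, hTW⟩, -⟩ := hrad 1 ⟨hδ.2, le_rfl⟩
  rw [dilate_one] at hTW
  set C := max ‖TA‖ ‖TW‖
  have hC : 0 ≤ C := le_max_of_le_left (norm_nonneg _)
  have hA : RowBounded f A C := (rowBounded_of_wotTendsto hTA.wot).mono (le_max_left _ _)
  have hW : RowBounded f (f.W m) C := (rowBounded_of_wotTendsto hTW).mono (le_max_right _ _)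
  have hJ : ∀ i x, (NSpace f m P).subtypeₗᵢ (star (BModel f m P i) x) =
    star (f.W m i) ((NSpace f m P).subtypeₗᵢ x) := coe_star_BModel
  refine pairMaps.map_one_mem_coneRad (E := NSpace f m P) (B := BModel f m P) hφ hC
    (hW.coinvariant hJ) hA hδ fun r hr s hs => nonneg_iff_inner.2 fun x => ?_
  rw [inner_defect_dilate_coinvariant hJ hW hC ⟨(hδ.1.trans hr.1).le, hr.2.le⟩]
  exact nonneg_iff_inner.1 ((hrad r ⟨hr.1, hr.2.le⟩).2 s hs) _

theorem CPMaps.ext {ψ : OpSystem f m P →ₗ[ℂ] (H →L[ℂ] H)} (hφ : φ ∈ CPMaps f m P A)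
    (hψ : ψ ∈ CPMaps f m P A) (h : φ (opOne f m P) = ψ (opOne f m P)) : φ = ψ :=
  pairMaps.ext (E := NSpace f m P) (B := BModel f m P) hφ hψ h

end Model

/-! ### Hilbert space tensor products and the operators T ⊗ I. -/

section Tensor

variable {E E' E'' F : Type*} [NormedAddCommGroup E] [InnerProductSpace ℂ E]
  [NormedAddCommGroup E'] [InnerProductSpace ℂ E'] [NormedAddCommGroup E'']
  [InnerProductSpace ℂ E''] [NormedAddCommGroup F] [InnerProductSpace ℂ F]

theorem htmul_add_left (x y : E) (z : F) : htmul (x + y) z = htmul x z + htmul y z := by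
  rw [htmul, TensorProduct.add_tmul, UniformSpace.Completion.coe_add]
  rfl

theorem htmul_add_right (x : E) (y z : F) : htmul x (y + z) = htmul x y + htmul x z := by
  rw [htmul, TensorProduct.tmul_add, UniformSpace.Completion.coe_add]
  rfl

theorem htmul_smul_left (c : ℂ) (x : E) (z : F) : htmul (c • x) z = c • htmul x z := by
  rw [htmul, htmul, ← TensorProduct.smul_tmul', UniformSpace.Completion.coe_smul]

theorem htmul_smul_right (c : ℂ) (x : E) (z : F) : htmul x (c • z) = c • htmul x z := by
  rw [htmul, htmul, TensorProduct.tmul_smul, UniformSpace.Completion.coe_smul]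

theorem htmul_zero_left (z : F) : htmul (0 : E) z = 0 := by
  simpa using htmul_smul_left 0 (0 : E) z

theorem inner_htmul (x x' : E) (y y' : F) :
    ⟪htmul x y, htmul x' y'⟫_ℂ = ⟪x, x'⟫_ℂ * ⟪y, y'⟫_ℂ := by
  simp [htmul]

theorem norm_htmul (x : E) (y : F) : ‖htmul x y‖ = ‖x‖ * ‖y‖ := by
  simp [htmul]

theorem continuous_htmul_left (y : F) : Continuous fun x : E => htmul x y := by
  refine (UniformSpace.Completion.continuous_coe _).comp ?_
  fun_prop

theorem htensor_induction {p : HTensor E F → Prop} (hc : IsClosed {z | p z})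
    (hadd : ∀ z w, p z → p w → p (z + w)) (ht : ∀ x y, p (htmul x y)) (z : HTensor E F) : p z := by
  refine UniformSpace.Completion.induction_on z hc fun z => ?_
  induction z with
  | zero => simpa [htmul] using ht 0 0
  | tmul x y => exact ht x y
  | add z w hz hw =>
    rw [UniformSpace.Completion.coe_add]
    exact hadd _ _ hz hw

theorem htensor_clm_ext {G : Type*} [NormedAddCommGroup G] [NormedSpace ℂ G]
    {S T : HTensor E F →L[ℂ] G} (h : ∀ x y, S (htmul x y) = T (htmul x y)) : S = T := by
  ext1 z
  refine htensor_induction (p := fun z => S z = T z) (isClosed_eq S.continuous T.continuous)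
    (fun z w hz hw => by rw [map_add, map_add, hz, hw]) h z

theorem eq_zero_of_inner_htmul {z : HTensor E F} (h : ∀ x y, ⟪htmul x y, z⟫_ℂ = 0) : z = 0 := by
  have h1 : innerSL ℂ z = 0 := htensor_clm_ext fun x y => by
    rw [innerSL_apply_apply, ← inner_conj_symm, h, map_zero]
    rfl
  rw [← inner_self_eq_zero (𝕜 := ℂ), ← innerSL_apply_apply ℂ, h1]
  rfl

theorem tensorId_add (S T : E →L[ℂ] E') : tensorId F (S + T) = tensorId F S + tensorId F T :=
  htensor_clm_ext fun x y => by
    rw [add_apply, tensorId_htmul, tensorId_htmul, tensorId_htmul, add_apply, htmul_add_left]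

theorem tensorId_smul (c : ℂ) (T : E →L[ℂ] E') : tensorId F (c • T) = c • tensorId F T :=
  htensor_clm_ext fun x y => by
    rw [smul_apply, tensorId_htmul, tensorId_htmul, smul_apply, htmul_smul_left]

theorem tensorId_one : tensorId F (1 : E →L[ℂ] E) = 1 :=
  htensor_clm_ext fun x y => by
    rw [tensorId_htmul, one_apply_eq_self, one_apply_eq_self]

theorem tensorId_comp_apply (S : E' →L[ℂ] E'') (T : E →L[ℂ] E') (z : HTensor E F) :
    tensorId F (S ∘L T) z = tensorId F S (tensorId F T z) := by
  have h : tensorId F (S ∘L T) = tensorId F S ∘L tensorId F T := htensor_clm_ext fun x y => by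
    rw [ContinuousLinearMap.comp_apply, tensorId_htmul, tensorId_htmul, tensorId_htmul,
      ContinuousLinearMap.comp_apply]
  rw [h]
  rfl

theorem norm_tensorId_le (T : E →L[ℂ] E') : ‖tensorId F T‖ ≤ ‖T‖ := by
  refine ContinuousLinearMap.opNorm_le_bound _ (norm_nonneg _) fun z => ?_
  refine UniformSpace.Completion.induction_on z
    (isClosed_le (by fun_prop) (by fun_prop)) fun z => ?_
  rw [tensorId, ContinuousLinearMap.completion_apply_coe, UniformSpace.Completion.norm_coe,
    UniformSpace.Completion.norm_coe]
  exact (ContinuousLinearMap.le_opNorm _ _).trans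
    (mul_le_mul_of_nonneg_right (ContinuousLinearMap.norm_rTensor_le _ _) (norm_nonneg _))

theorem inner_htmul_tensorId [CompleteSpace E] [CompleteSpace E'] (T : E →L[ℂ] E') (x : E')
    (y : F) (z : HTensor E F) :
    ⟪htmul x y, tensorId F T z⟫_ℂ = ⟪htmul (ContinuousLinearMap.adjoint T x) y, z⟫_ℂ := by
  refine htensor_induction (p := fun z => ⟪htmul x y, tensorId F T z⟫_ℂ =
    ⟪htmul (ContinuousLinearMap.adjoint T x) y, z⟫_ℂ)
    (isClosed_eq (by fun_prop) (by fun_prop)) (fun z w hz hw => ?_) (fun x' y' => ?_) z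
  · rw [map_add, inner_add_right, inner_add_right, hz, hw]
  · rw [tensorId_htmul, inner_htmul, inner_htmul, ContinuousLinearMap.adjoint_inner_left]

theorem inner_tensorId_left [CompleteSpace E] [CompleteSpace E'] (T : E →L[ℂ] E')
    (z : HTensor E F) (w : HTensor E' F) :
    ⟪tensorId F (ContinuousLinearMap.adjoint T) w, z⟫_ℂ = ⟪w, tensorId F T z⟫_ℂ := by
  refine htensor_induction (p := fun w => ⟪tensorId F (ContinuousLinearMap.adjoint T) w, z⟫_ℂ =
    ⟪w, tensorId F T z⟫_ℂ)
    (isClosed_eq (by fun_prop) (by fun_prop)) (fun z w hz hw => ?_) (fun x' y' => ?_) w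
  · rw [map_add, inner_add_left, inner_add_left, hz, hw]
  · rw [tensorId_htmul, inner_htmul_tensorId]

/-- By density it suffices to test on algebraic tensors. Expanded along an orthonormal basis of the
second factor, the form splits into a sum of copies of the form of T. -/
theorem matrixPos_tensorId {k : ℕ} {T : Fin k → Fin k → E →L[ℂ] E} (hT : MatrixPos T) :
    MatrixPos fun i j => tensorId F (T i j) := by
  intro z
  have hdense : DenseRange (Pi.map fun (_ : Fin k) (x : E ⊗[ℂ] F) =>
      (x : UniformSpace.Completion (E ⊗[ℂ] F))) :=
    DenseRange.piMap fun _ => UniformSpace.Completion.denseRange_coe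
  refine hdense.induction_on (p := fun z : Fin k → HTensor E F =>
    0 ≤ ∑ i, ∑ j, ⟪z i, tensorId F (T i j) (z j)⟫_ℂ) z
    (isClosed_le continuous_const (by fun_prop)) fun w => ?_
  -- Finitely many algebraic tensors share one finite-dimensional space of second legs, hence one
  -- orthonormal basis.
  obtain ⟨N, hN, hw⟩ :=
    TensorProduct.exists_finite_submodule_right_of_setFinite (Set.range w) (Set.finite_range w)
  let b := stdOrthonormalBasis ℂ N
  have h1 : ∀ i, ∃ c : Fin (Module.finrank ℂ N) → E, w i = ∑ p, c p ⊗ₜ[ℂ] (b p : F) := by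
    intro i
    obtain ⟨v, hv⟩ := hw ⟨i, rfl⟩
    obtain ⟨c, hc⟩ := TensorProduct.eq_repr_basis_right b.toBasis v
    refine ⟨c, ?_⟩
    rw [← hv, ← hc, Finsupp.sum_fintype _ _ (by simp), map_sum]
    exact Finset.sum_congr rfl fun p _ => by simp
  choose c hc using h1
  have h2 : ∀ i j, ⟪((w i : E ⊗[ℂ] F) : HTensor E F), tensorId F (T i j) (w j)⟫_ℂ =
      ∑ p, ⟪c i p, T i j (c j p)⟫_ℂ := by
    intro i j
    rw [tensorId, ContinuousLinearMap.completion_apply_coe, UniformSpace.Completion.inner_coe,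
      hc i, hc j, map_sum, sum_inner]
    refine Finset.sum_congr rfl fun p _ => ?_
    rw [inner_sum, Finset.sum_eq_single p]
    · rw [ContinuousLinearMap.rTensor_tmul, TensorProduct.inner_tmul, ← Submodule.coe_inner,
        orthonormal_iff_ite.1 b.orthonormal]
      simp
    · intro q _ hq
      rw [ContinuousLinearMap.rTensor_tmul, TensorProduct.inner_tmul, ← Submodule.coe_inner,
        orthonormal_iff_ite.1 b.orthonormal, if_neg hq.symm, mul_zero]
    · simp
  change 0 ≤ ∑ i, ∑ j, ⟪((w i : E ⊗[ℂ] F) : HTensor E F), tensorId F (T i j) (w j)⟫_ℂ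
  simp only [h2]
  have h3 : ∑ i, ∑ j, ∑ p, ⟪c i p, T i j (c j p)⟫_ℂ =
      ∑ p, ∑ i, ∑ j, ⟪c i p, T i j (c j p)⟫_ℂ :=
    (Finset.sum_congr rfl fun i _ => Finset.sum_comm).trans Finset.sum_comm
  rw [h3]
  exact Finset.sum_nonneg fun p _ => hT fun i => c i p

end Tensor

/-! ### The compressions χ ↦ K^*(χ ⊗ I)K. -/

section Compression

variable {E F H : Type*} [NormedAddCommGroup E] [InnerProductSpace ℂ E]
  [NormedAddCommGroup F] [InnerProductSpace ℂ F]
  [NormedAddCommGroup H] [InnerProductSpace ℂ H] [CompleteSpace H]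

/-- The linear map `χ ↦ K^* (χ ⊗ I) K`. -/
def tensorCompression (K : H →L[ℂ] HTensor E F) : (E →L[ℂ] E) →ₗ[ℂ] (H →L[ℂ] H) where
  toFun χ := ContinuousLinearMap.adjoint K ∘L tensorId F χ ∘L K
  map_add' S T := by
    rw [tensorId_add, ContinuousLinearMap.add_comp, ContinuousLinearMap.comp_add]
  map_smul' c T := by
    rw [tensorId_smul, ContinuousLinearMap.smul_comp, ContinuousLinearMap.comp_smul]
    rfl

/-- The operator `K^* K`. -/
def tensorGram (K : H →L[ℂ] HTensor E F) : H →L[ℂ] H := ContinuousLinearMap.adjoint K ∘L K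

theorem inner_tensorGram (K : H →L[ℂ] HTensor E F) (x y : H) :
    ⟪x, tensorGram K y⟫_ℂ = ⟪K x, K y⟫_ℂ :=
  ContinuousLinearMap.adjoint_inner_right K x _

theorem inner_tensorCompression (K : H →L[ℂ] HTensor E F) (χ : E →L[ℂ] E) (x y : H) :
    ⟪x, tensorCompression K χ y⟫_ℂ = ⟪K x, tensorId F χ (K y)⟫_ℂ :=
  ContinuousLinearMap.adjoint_inner_right K x _

theorem norm_tensorCompression_le {K : H →L[ℂ] HTensor E F} {D : H →L[ℂ] H}
    (hK : tensorGram K = D) (χ : E →L[ℂ] E) :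
    ‖tensorCompression K χ‖ ≤ ‖D‖ * ‖χ‖ := by
  have h1 : ‖D‖ = ‖K‖ * ‖K‖ := by
    rw [← hK]
    exact ContinuousLinearMap.norm_adjoint_comp_self K
  calc ‖tensorCompression K χ‖ ≤ ‖ContinuousLinearMap.adjoint K‖ * (‖tensorId F χ‖ * ‖K‖) :=
        (ContinuousLinearMap.opNorm_comp_le _ _).trans
          (by gcongr; exact ContinuousLinearMap.opNorm_comp_le _ _)
    _ ≤ ‖K‖ * (‖χ‖ * ‖K‖) := by
        rw [LinearIsometryEquiv.norm_map]
        gcongr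
        exact norm_tensorId_le χ
    _ = ‖D‖ * ‖χ‖ := by rw [h1]; ring

theorem matrixPos_tensorCompression (K : H →L[ℂ] HTensor E F) {k : ℕ}
    {T : Fin k → Fin k → E →L[ℂ] E} (hT : MatrixPos T) :
    MatrixPos fun i j => tensorCompression K (T i j) := by
  intro h
  simp only [inner_tensorCompression]
  exact matrixPos_tensorId hT fun i => K (h i)

/-- The intertwining extends from letters to words, so both B_β^* and the adjoint of B_α pass
through K, leaving K^*K = D in the middle. -/
theorem tensorCompression_wordPair [CompleteSpace E] {n : ℕ} {B : Fin n → E →L[ℂ] E}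
    {X : Fin n → H →L[ℂ] H} {K : H →L[ℂ] HTensor E F} {D : H →L[ℂ] H}
    (hK : tensorGram K = D)
    (hB : ∀ i h, tensorId F (star (B i)) (K h) = K (star (X i) h)) (α β : Word n) :
    tensorCompression K (wordPair B α β) = wordProd X α * D * star (wordProd X β) := by
  have hw : ∀ α h, tensorId F (star (wordProd B α)) (K h) = K (star (wordProd X α) h) := by
    intro α
    induction α with
    | nil => intro h; rw [wordProd_nil, wordProd_nil, star_one, star_one, tensorId_one]; rfl
    | cons i α ih =>
      intro h
      rw [wordProd_cons, wordProd_cons, star_mul, star_mul, ContinuousLinearMap.mul_def,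
        tensorId_comp_apply, hB, ih]
      rfl
  refine ContinuousLinearMap.ext fun y => ext_inner_left ℂ fun x => ?_
  rw [inner_tensorCompression, wordPair, ContinuousLinearMap.mul_def, tensorId_comp_apply, hw,
    ← inner_tensorId_left, ← ContinuousLinearMap.star_eq_adjoint, hw,
    ← inner_tensorGram, hK, ContinuousLinearMap.star_eq_adjoint,
    ContinuousLinearMap.adjoint_inner_left]
  rfl

end Compression

/-! ### Point-norm limits of uniformly bounded completely positive maps. -/

section Limit

variable {n : ℕ} {E : Type*} [NormedAddCommGroup E] [InnerProductSpace ℂ E] [CompleteSpace E]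
  {H : Type*} [NormedAddCommGroup H] [InnerProductSpace ℂ H] [CompleteSpace H]
  {B : Fin n → E →L[ℂ] E} {A : Fin n → H →L[ℂ] H} {D : H →L[ℂ] H}
  {ι : Type*} {l : Filter ι} [l.NeBot] {Ψ : ι → (E →L[ℂ] E) →ₗ[ℂ] (H →L[ℂ] H)}

/-- The usual ε-argument: the uniform bound M makes the family Cauchy at χ once it converges at a
nearby point, and B(H) is complete. -/
theorem isClosed_exists_tendsto {M : ℝ}
    (hb : ∀ᶠ i in l, ∀ χ, ‖Ψ i χ‖ ≤ M * ‖χ‖) :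
    IsClosed {χ | ∃ L, Tendsto (fun i => Ψ i χ) l (𝓝 L)} := by
  rw [← isSeqClosed_iff_isClosed]
  intro u χ hu hχ
  change ∃ L, Tendsto (fun i => Ψ i χ) l (𝓝 L)
  rw [← cauchy_map_iff_exists_tendsto, Metric.cauchy_iff]
  refine ⟨inferInstance, fun ε hε => ?_⟩
  have h1 : Tendsto (fun k => M * ‖u k - χ‖) atTop (𝓝 0) := by
    have := ((tendsto_iff_norm_sub_tendsto_zero.1 hχ).const_mul M)
    simpa using this
  obtain ⟨k, hk⟩ := (h1.eventually_lt_const (by positivity : 0 < ε / 4)).exists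
  obtain ⟨L, hL⟩ := hu k
  refine ⟨Metric.ball L (ε / 2), ?_, ?_⟩
  · rw [mem_map]
    filter_upwards [hb, hL (Metric.ball_mem_nhds L (by positivity : 0 < ε / 4))] with i h2 h3
    rw [Set.mem_preimage, mem_ball_iff_norm] at h3
    rw [Set.mem_preimage, mem_ball_iff_norm]
    calc ‖Ψ i χ - L‖ = ‖(Ψ i (u k) - L) - Ψ i (u k - χ)‖ := by
          rw [map_sub]; congr 1; abel
      _ ≤ ‖Ψ i (u k) - L‖ + ‖Ψ i (u k - χ)‖ := norm_sub_le _ _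
      _ < ε / 4 + ε / 4 := add_lt_add_of_lt_of_le h3 ((h2 _).trans hk.le)
      _ = ε / 2 := by ring
  · intro x hx y hy
    calc dist x y ≤ dist x L + dist y L := dist_triangle_right _ _ _
      _ < ε / 2 + ε / 2 := add_lt_add hx hy
      _ = ε := by ring

theorem exists_pairMap_of_tendsto {M : ℝ}
    (hb : ∀ᶠ i in l, ∀ χ, ‖Ψ i χ‖ ≤ M * ‖χ‖)
    (hpos : ∀ i (k : ℕ) (T : Fin k → Fin k → E →L[ℂ] E), MatrixPos T →
      MatrixPos fun p q => Ψ i (T p q))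
    (hlim : ∀ α β, Tendsto (fun i => Ψ i (wordPair B α β)) l
      (𝓝 (wordProd A α * D * star (wordProd A β)))) :
    ∃ φ ∈ pairMaps B A, φ (pairOne B) = D ∧
      ∀ χ : pairSystem B, Tendsto (fun i => Ψ i χ) l (𝓝 (φ χ)) := by
  have hex : ∀ χ : pairSystem B, ∃ L, Tendsto (fun i => Ψ i χ) l (𝓝 L) := fun χ =>
    pairSystem_induction (p := fun χ => ∃ L, Tendsto (fun i => Ψ i χ) l (𝓝 L))
      (q := { carrier := {χ | ∃ L, Tendsto (fun i => Ψ i χ) l (𝓝 L)}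
              add_mem' := fun {S T} ⟨L, hL⟩ ⟨L', hL'⟩ => ⟨L + L', by
                simpa only [map_add] using hL.add hL'⟩
              zero_mem' := ⟨0, by simpa only [map_zero] using tendsto_const_nhds⟩
              smul_mem' := fun c T ⟨L, hL⟩ => ⟨c • L, by
                simpa only [map_smul] using hL.const_smul c⟩ })
      (fun _ => Iff.rfl) (isClosed_exists_tendsto hb) (fun α β => ⟨_, hlim α β⟩) χ.2
  choose g hg using hex
  let φ : pairSystem B →ₗ[ℂ] (H →L[ℂ] H) :=
    { toFun := g
      map_add' := fun S T => tendsto_nhds_unique (hg (S + T)) (by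
        simpa only [Submodule.coe_add, map_add] using (hg S).add (hg T))
      map_smul' := fun c T => tendsto_nhds_unique (hg (c • T)) (by
        simpa only [Submodule.coe_smul, map_smul, RingHom.id_apply] using (hg T).const_smul c) }
  have hφ : ∀ α β, φ (pairElem B α β) = wordProd A α * D * star (wordProd A β) := fun α β =>
    tendsto_nhds_unique (hg (pairElem B α β)) (hlim α β)
  have h1 : φ (pairOne B) = D := by
    have h2 := hφ [] []
    have h3 : pairElem B [] [] = pairOne B := Subtype.ext (by simp [pairElem, pairOne, wordPair])
    rw [h3] at h2
    simpa using h2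
  refine ⟨φ, ⟨fun k T hT h => ?_, fun α β => by rw [hφ, h1]⟩, h1, hg⟩
  have h4 : Tendsto (fun i => ∑ p, ∑ q, ⟪h p, Ψ i (T p q) (h q)⟫_ℂ) l
      (𝓝 (∑ p, ∑ q, ⟪h p, φ (T p q) (h q)⟫_ℂ)) := by
    refine tendsto_finsetSum _ fun p _ => tendsto_finsetSum _ fun q _ => ?_
    exact tendsto_const_nhds.inner
      (((ContinuousLinearMap.apply ℂ H (h q)).continuous.tendsto _).comp (hg (T p q)))
  exact ge_of_tendsto h4 (Eventually.of_forall fun i => hpos i k _ hT h)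

end Limit

/-! ### Adjoints of the weighted creation operators on basis vectors. -/

section Fock

variable {n : ℕ}

theorem PosRegular.weight_pos (f : PosRegular n) (m : ℕ) (α : Word n) : 0 < f.weight m α := by
  induction α with
  | nil => rw [f.weight_nil]; exact one_pos
  | cons i α ih => exact (mul_pos (f.coeff_letter i) ih).trans_le (f.coeff_mul_weight_le m i α)

theorem inner_basisVec (α : Word n) (x : Fock n) : ⟪basisVec α, x⟫_ℂ = x α := by
  rw [basisVec, lp.inner_single_left]
  simp

theorem basisVec_apply (α β : Word n) : (basisVec α : Fock n) β = if β = α then 1 else 0 := by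
  rw [basisVec, lp.single_apply, Pi.single_apply]

theorem star_W_basisVec_nil (f : PosRegular n) (m : ℕ) (i : Fin n) :
    star (f.W m i) (basisVec []) = 0 := by
  ext γ
  rw [← inner_basisVec, ContinuousLinearMap.star_eq_adjoint,
    ContinuousLinearMap.adjoint_inner_right, PosRegular.W, weightedShift_basisVec,
    inner_smul_left, inner_basisVec, basisVec_apply]
  simp

theorem star_W_basisVec_cons (f : PosRegular n) (m : ℕ) (i j : Fin n) (α : Word n) :
    star (f.W m i) (basisVec (j :: α)) =
      if j = i then (√(f.weight m α / f.weight m (i :: α)) : ℂ) • basisVec α else 0 := by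
  ext γ
  rw [← inner_basisVec, ContinuousLinearMap.star_eq_adjoint,
    ContinuousLinearMap.adjoint_inner_right, PosRegular.W, weightedShift_basisVec,
    inner_smul_left, inner_basisVec, basisVec_apply, Complex.conj_ofReal]
  by_cases hij : j = i
  · subst hij
    rw [if_pos rfl]
    change _ = ((√(f.weight m α / f.weight m (j :: α)) : ℝ) : ℂ) * (basisVec α : Fock n) γ
    rw [basisVec_apply]
    by_cases h : γ = α
    · subst h
      simp
    · simp [h]
  · simp [hij, Ne.symm hij]

end Fock

/-! ### The Berezin kernel: existence, Gram operator, intertwining, range. -/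

section Kernel

variable {n : ℕ} {H : Type*} [NormedAddCommGroup H] [InnerProductSpace ℂ H] [CompleteSpace H]
  {f : PosRegular n} {m : ℕ} {X : Fin n → H →L[ℂ] H} {R D : H →L[ℂ] H}

theorem norm_sqrtVec_sq (hR : 0 ≤ R) (x : H) : ‖sqrtVec R x‖ ^ 2 = (⟪R x, x⟫_ℂ).re := by
  have h1 : IsSelfAdjoint (CFC.sqrt R) := (CFC.sqrt_nonneg R).isSelfAdjoint
  have h2 : ⟪R x, x⟫_ℂ = ⟪CFC.sqrt R x, CFC.sqrt R x⟫_ℂ := by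
    conv_lhs => rw [← CFC.sqrt_mul_sqrt_self R hR]
    rw [mul_apply_eq_comp, ← ContinuousLinearMap.adjoint_inner_right,
      ← ContinuousLinearMap.star_eq_adjoint, h1.star_eq]
  rw [h2, inner_self_eq_norm_sq_to_K]
  change ‖CFC.sqrt R x‖ ^ 2 = _
  norm_cast

theorem sqrtVec_add (x y : H) : sqrtVec R (x + y) = sqrtVec R x + sqrtVec R y :=
  Subtype.ext (map_add (CFC.sqrt R) x y)

theorem sqrtVec_smul (c : ℂ) (x : H) : sqrtVec R (c • x) = c • sqrtVec R x :=
  Subtype.ext (map_smul (CFC.sqrt R) c x)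

/-- The isometry `y ↦ e_α ⊗ y`. -/
def basisTensor (F : Type*) [NormedAddCommGroup F] [InnerProductSpace ℂ F] (α : Word n) :
    F →ₗᵢ[ℂ] HTensor (Fock n) F where
  toFun y := htmul (basisVec α) y
  map_add' y z := htmul_add_right _ y z
  map_smul' c y := htmul_smul_right c _ y
  norm_map' y := by
    change ‖htmul (basisVec α) y‖ = ‖y‖
    rw [norm_htmul, basisVec, lp.norm_single (by norm_num)]
    simp

theorem orthogonalFamily_basisTensor (F : Type*) [NormedAddCommGroup F] [InnerProductSpace ℂ F] :
    OrthogonalFamily ℂ (fun _ : Word n => F) (basisTensor F) := by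
  intro α β h y z
  change ⟪htmul (basisVec α) y, htmul (basisVec β) z⟫_ℂ = 0
  rw [inner_htmul, inner_basisVec, basisVec_apply, if_neg h, zero_mul]

/-- The summand `√b_α e_α ⊗ R^{1/2} X_α^* h` of the Berezin kernel. -/
def kernelTerm (f : PosRegular n) (m : ℕ) (X : Fin n → H →L[ℂ] H) (R : H →L[ℂ] H) (h : H)
    (α : Word n) : HTensor (Fock n) (RSpace R) :=
  (√(f.weight m α) : ℂ) • htmul (basisVec α) (sqrtVec R (star (wordProd X α) h))

theorem kernelTerm_eq (h : H) (α : Word n) :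
    kernelTerm f m X R h α = basisTensor (RSpace R) α
      ((√(f.weight m α) : ℂ) • sqrtVec R (star (wordProd X α) h)) := by
  rw [map_smul]
  rfl

theorem norm_smul_sqrtVec_sq (hR : 0 ≤ R) (h : H) (α : Word n) :
    ‖(√(f.weight m α) : ℂ) • sqrtVec R (star (wordProd X α) h)‖ ^ 2 =
      f.weight m α * conjForm X R h α := by
  rw [norm_smul, mul_pow, norm_sqrtVec_sq hR, Complex.norm_real, Real.norm_eq_abs, sq_abs,
    Real.sq_sqrt (f.weight_nonneg m α)]
  rfl

theorem summable_kernelTerm (hR : 0 ≤ R)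
    (hD : ∀ h, HasSum (fun α => f.weight m α * conjForm X R h α) (⟪D h, h⟫_ℂ).re) (h : H) :
    Summable (kernelTerm f m X R h) := by
  have h1 := ((orthogonalFamily_basisTensor (n := n) (RSpace R)).summable_iff_norm_sq_summable
    fun α => (√(f.weight m α) : ℂ) • sqrtVec R (star (wordProd X α) h)).2
      (by simpa only [norm_smul_sqrtVec_sq hR] using (hD h).summable)
  simpa only [← kernelTerm_eq] using h1

theorem norm_tsum_kernelTerm_sq (hR : 0 ≤ R)
    (hD : ∀ h, HasSum (fun α => f.weight m α * conjForm X R h α) (⟪D h, h⟫_ℂ).re) (h : H) :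
    ‖∑' α, kernelTerm f m X R h α‖ ^ 2 = (⟪D h, h⟫_ℂ).re := by
  refine tendsto_nhds_unique ((summable_kernelTerm hR hD h).hasSum.norm.pow 2)
    ((hD h).congr fun s => ?_)
  have h1 := (orthogonalFamily_basisTensor (n := n) (RSpace R)).norm_sum
    (fun α => (√(f.weight m α) : ℂ) • sqrtVec R (star (wordProd X α) h)) s
  simp only [← kernelTerm_eq, norm_smul_sqrtVec_sq hR] at h1
  exact h1.symm

/-- The summands for different words are orthogonal, so the series converges exactly when its
squared norms are summable; these add up to ⟪D h, h⟫, whence the bound √‖D‖. -/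
theorem exists_isBerezinKernel (hR : 0 ≤ R)
    (hD : ∀ h, HasSum (fun α => f.weight m α * conjForm X R h α) (⟪D h, h⟫_ℂ).re) :
    ∃ K, IsBerezinKernel f m X R K := by
  refine ⟨LinearMap.mkContinuous
    { toFun := fun h => ∑' α, kernelTerm f m X R h α
      map_add' := fun x y => ?_
      map_smul' := fun c x => ?_ } (√‖D‖) fun x => ?_, fun h => (summable_kernelTerm hR hD h).hasSum⟩
  · rw [← (summable_kernelTerm hR hD x).tsum_add (summable_kernelTerm hR hD y)]
    refine tsum_congr fun α => ?_
    rw [kernelTerm, map_add, sqrtVec_add, htmul_add_right, smul_add]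
    rfl
  · rw [RingHom.id_apply, ← (summable_kernelTerm hR hD x).tsum_const_smul c]
    refine tsum_congr fun α => ?_
    rw [kernelTerm, map_smul, sqrtVec_smul, htmul_smul_right, smul_comm]
    rfl
  · change ‖∑' α, kernelTerm f m X R x α‖ ≤ _
    refine le_of_sq_le_sq ?_ (by positivity)
    rw [norm_tsum_kernelTerm_sq hR hD, mul_pow, Real.sq_sqrt (norm_nonneg D)]
    calc (⟪D x, x⟫_ℂ).re ≤ ‖D x‖ * ‖x‖ := re_inner_le_norm (𝕜 := ℂ) _ _
      _ ≤ ‖D‖ * ‖x‖ * ‖x‖ := by gcongr; exact D.le_opNorm x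
      _ = _ := by ring

variable {K : H →L[ℂ] HTensor (Fock n) (RSpace R)}

/-- Over ℂ an operator is determined by its quadratic form, and ‖K x‖² = ⟪D x, x⟫ by Pythagoras. -/
theorem IsBerezinKernel.tensorGram_eq (hK : IsBerezinKernel f m X R K) (hR : 0 ≤ R)
    (hD0 : 0 ≤ D)
    (hD : ∀ h, HasSum (fun α => f.weight m α * conjForm X R h α) (⟪D h, h⟫_ℂ).re) :
    tensorGram K = D := by
  refine ContinuousLinearMap.coe_injective ((ext_inner_map _ _).1 fun x => ?_)
  rw [ContinuousLinearMap.coe_coe, ContinuousLinearMap.coe_coe, ← inner_conj_symm, inner_tensorGram,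
    inner_conj_symm, inner_self_eq_norm_sq_to_K]
  have h1 : K x = ∑' α, kernelTerm f m X R x α := (hK x).tsum_eq.symm
  have h2 := norm_tsum_kernelTerm_sq hR hD x
  rw [← h1] at h2
  have h3 := Complex.nonneg_iff.1 (nonneg_iff_inner.1 hD0 x)
  refine Complex.ext ?_ ?_
  · rw [← h2]
    norm_cast
  · rw [← h3.2]
    norm_cast

/-- W_i^* removes a leading g_i and kills the other basis vectors. The shift weight √(b_γ / b_{g_i
γ}) is chosen so that multiplying by √b_{g_i γ} leaves √b_γ. -/
theorem IsBerezinKernel.intertwine (hK : IsBerezinKernel f m X R K) (i : Fin n) (h : H) :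
    tensorId (RSpace R) (star (f.W m i)) (K h) = K (star (X i) h) := by
  refine ((tensorId (RSpace R) (star (f.W m i))).hasSum (hK h)).unique ?_
  refine ((List.cons_injective (a := i)).hasSum_iff ?_).1 ((hK (star (X i) h)).congr_fun ?_)
  · intro α hα
    rw [map_smul, tensorId_htmul]
    rcases α with _ | ⟨j, γ⟩
    · rw [star_W_basisVec_nil]
      rw [htmul_zero_left, smul_zero]
    · have : j ≠ i := fun hj => hα ⟨γ, by rw [hj]⟩
      rw [star_W_basisVec_cons, if_neg this]
      rw [htmul_zero_left, smul_zero]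
  · intro γ
    simp only [Function.comp_apply]
    rw [map_smul, tensorId_htmul, star_W_basisVec_cons, if_pos rfl, htmul_smul_left, smul_smul,
      wordProd_cons, star_mul, mul_apply_eq_comp]
    congr 1
    rw [← Complex.ofReal_mul, ← Real.sqrt_mul (f.weight_nonneg m _),
      mul_div_cancel₀ _ (f.weight_pos m _).ne']

theorem IsBerezinKernel.intertwine_wordProd (hK : IsBerezinKernel f m X R K) (α : Word n) (h : H) :
    tensorId (RSpace R) (star (wordProd (f.W m) α)) (K h) = K (star (wordProd X α) h) := by
  induction α generalizing h with
  | nil => rw [wordProd_nil, wordProd_nil, star_one, star_one, tensorId_one]; rfl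
  | cons i α ih =>
    rw [wordProd_cons, wordProd_cons, star_mul, star_mul, ContinuousLinearMap.mul_def,
      tensorId_comp_apply, hK.intertwine, ih]
    rfl

theorem IsBerezinKernel.intertwine_polyEval (hK : IsBerezinKernel f m X R K)
    (p : FreeAlgebra ℂ (Fin n)) (h : H) :
    tensorId (RSpace R) (star (polyEval (f.W m) p)) (K h) = K (star (polyEval X p) h) := by
  simp only [polyEval]
  induction p using FreeAlgebra.induction generalizing h with
  | grade0 c =>
    rw [AlgHom.commutes, AlgHom.commutes, Algebra.algebraMap_eq_smul_one,
      Algebra.algebraMap_eq_smul_one, star_smul, star_smul, star_one, star_one, tensorId_smul,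
      tensorId_one, smul_apply, smul_apply, map_smul]
    rfl
  | grade1 i =>
    rw [FreeAlgebra.lift_ι_apply, FreeAlgebra.lift_ι_apply]
    exact hK.intertwine i h
  | mul p q hp hq =>
    rw [map_mul, map_mul, star_mul, star_mul, ContinuousLinearMap.mul_def, tensorId_comp_apply,
      hp, hq]
    rfl
  | add p q hp hq =>
    rw [map_add, map_add, star_add, star_add, tensorId_add, add_apply, add_apply, hp, hq, map_add]

variable {P : Set (FreeAlgebra ℂ (Fin n))}

/-- Moving W_α p(W) W_β to the other side of the inner product turns it into adjoints in X, among
them p(X)^* = 0. -/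
theorem IsBerezinKernel.inner_MSpace (hK : IsBerezinKernel f m X R K)
    (hP : ∀ p ∈ P, polyEval X p = 0) {u : Fock n} (hu : u ∈ MSpace f m P) (y : RSpace R) (h : H) :
    ⟪htmul u y, K h⟫_ℂ = 0 := by
  let q : Submodule ℂ (Fock n) :=
    { carrier := {u | ⟪htmul u y, K h⟫_ℂ = 0}
      add_mem' := fun {u v} hu hv => by
        change ⟪htmul (u + v) y, K h⟫_ℂ = 0
        rw [htmul_add_left, inner_add_left, hu, hv, add_zero]
      zero_mem' := by
        change ⟪htmul 0 y, K h⟫_ℂ = 0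
        rw [htmul_zero_left, inner_zero_left]
      smul_mem' := fun c u hu => by
        change ⟪htmul (c • u) y, K h⟫_ℂ = 0
        rw [htmul_smul_left, inner_smul_left, hu, mul_zero] }
  have hle : MSpace f m P ≤ q := by
    refine Submodule.topologicalClosure_minimal _ ?_
      (isClosed_eq ((continuous_htmul_left y).inner continuous_const) continuous_const)
    rw [Submodule.span_le]
    rintro _ ⟨p, hp, α, β, rfl⟩
    change ⟪htmul _ y, K h⟫_ℂ = 0
    have key : ∀ (S : Fock n →L[ℂ] Fock n) (x : Fock n) (z : HTensor (Fock n) (RSpace R)),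
        ⟪htmul (S x) y, z⟫_ℂ = ⟪htmul x y, tensorId (RSpace R) (star S) z⟫_ℂ := by
      intro S x z
      rw [inner_htmul_tensorId, ContinuousLinearMap.star_eq_adjoint,
        ContinuousLinearMap.adjoint_adjoint]
    rw [key, hK.intertwine_wordProd, key, hK.intertwine_polyEval, hP p hp, star_zero]
    simp
  exact hle hu

theorem IsBerezinKernel.tensorId_proj (hK : IsBerezinKernel f m X R K)
    (hP : ∀ p ∈ P, polyEval X p = 0) (h : H) :
    tensorId (RSpace R) (NSpace f m P).subtypeL (tensorId (RSpace R) (PN f m P) (K h)) = K h := by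
  rw [← sub_eq_zero]
  refine eq_zero_of_inner_htmul fun x y => ?_
  rw [inner_sub_right, inner_htmul_tensorId, inner_htmul_tensorId, ← inner_sub_left]
  have h1 : (ContinuousLinearMap.adjoint (PN f m P))
      (ContinuousLinearMap.adjoint (NSpace f m P).subtypeL x) = (PN f m P x : Fock n) := by
    rw [PN, Submodule.adjoint_orthogonalProjectionOnto, Submodule.adjoint_subtypeL]
    rfl
  rw [h1]
  -- M_P is closed, so it is its own double orthocomplement.
  have h2 : x - (PN f m P x : Fock n) ∈ MSpace f m P := by
    have h3 : x - (PN f m P x : Fock n) ∈ (MSpace f m P)ᗮᗮ :=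
      (NSpace f m P).sub_starProjection_mem_orthogonal x
    have h4 : CompleteSpace (MSpace f m P) :=
      (Submodule.isClosed_topologicalClosure _).completeSpace_coe
    rwa [Submodule.orthogonal_orthogonal] at h3
  have h5 : htmul (PN f m P x : Fock n) y - htmul x y = -htmul (x - (PN f m P x : Fock n)) y := by
    rw [eq_neg_iff_add_eq_zero, sub_add, sub_eq_zero, eq_sub_iff_add_eq, ← htmul_add_left,
      add_sub_cancel]
  rw [h5, inner_neg_left, hK.inner_MSpace hP h2, neg_zero]

end Kernel

/-! ### Homogeneous relations are stable under dilation. -/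

section Homogeneous

variable {n : ℕ} {H : Type*} [NormedAddCommGroup H] [InnerProductSpace ℂ H] [CompleteSpace H]

theorem polyEval_wordProd (X : Fin n → H →L[ℂ] H) (α : Word n) :
    polyEval X (wordProd (FreeAlgebra.ι ℂ) α) = wordProd X α := by
  rw [polyEval, wordProd, map_list_prod, List.map_map, wordProd]
  congr 2
  ext1 i
  exact FreeAlgebra.lift_ι_apply X i

theorem polyEval_dilate {p : FreeAlgebra ℂ (Fin n)} (hp : IsHomogeneousPoly p)
    {A : Fin n → H →L[ℂ] H} (hA : polyEval A p = 0) (r : ℝ) : polyEval (dilate r A) p = 0 := by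
  obtain ⟨d, hd⟩ := hp
  have h1 : polyEval (dilate r A) p = (r : ℂ) ^ d • polyEval A p := by
    clear hA
    induction hd using Submodule.span_induction with
    | mem q hq =>
      obtain ⟨α, rfl, rfl⟩ := hq
      rw [polyEval_wordProd, polyEval_wordProd, wordProd_dilate]
    | zero => simp [polyEval]
    | add q q' _ _ hq hq' =>
      simp only [polyEval, map_add, smul_add] at hq hq' ⊢
      rw [hq, hq']
    | smul c q _ hq =>
      simp only [polyEval, map_smul] at hq ⊢
      rw [hq, smul_comm]
  rw [h1, hA, smul_zero]

end Homogeneous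

/-! ### Transfer of the kernel identities to N_P ⊗ R. -/

section Constrained

variable {n : ℕ} {H : Type*} [NormedAddCommGroup H] [InnerProductSpace ℂ H] [CompleteSpace H]
  {f : PosRegular n} {m : ℕ} {P : Set (FreeAlgebra ℂ (Fin n))} {X : Fin n → H →L[ℂ] H}
  {R D : H →L[ℂ] H}

theorem tensorGram_constrainedKernel (hK : IsBerezinKernel f m X R (berezinKernel f m X R))
    (hP : ∀ p ∈ P, polyEval X p = 0)
    (hD : tensorGram (berezinKernel f m X R) = D) :
    tensorGram (constrainedKernel f m P X R) = D := by
  rw [← hD]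
  refine ContinuousLinearMap.ext fun y => ext_inner_left ℂ fun x => ?_
  rw [inner_tensorGram, inner_tensorGram]
  have h1 := inner_tensorId_left (PN f m P) (berezinKernel f m X R y)
    (constrainedKernel f m P X R x)
  refine h1.symm.trans ?_
  rw [PN, Submodule.adjoint_orthogonalProjectionOnto]
  congr 1
  exact hK.tensorId_proj hP x

theorem tensorId_star_BModel_constrainedKernel
    (hK : IsBerezinKernel f m X R (berezinKernel f m X R)) (hP : ∀ p ∈ P, polyEval X p = 0)
    (i : Fin n) (h : H) :
    tensorId (RSpace R) (star (BModel f m P i)) (constrainedKernel f m P X R h) =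
      constrainedKernel f m P X R (star (X i) h) := by
  rw [star_BModel, tensorId_comp_apply, tensorId_comp_apply]
  have h1 := hK.tensorId_proj hP h
  change tensorId _ (PN f m P) (tensorId _ (star (f.W m i)) (tensorId _ (NSpace f m P).subtypeL
    (tensorId (RSpace R) (PN f m P) (berezinKernel f m X R h)))) = _
  rw [h1, hK.intertwine]
  rfl

end Constrained

/-! ### Kernels of an element of the radial cone, and their limit. -/

section Radial

variable {n : ℕ} {H : Type*} [NormedAddCommGroup H] [InnerProductSpace ℂ H] [CompleteSpace H]
  {f : PosRegular n} {m : ℕ} {P : Set (FreeAlgebra ℂ (Fin n))} {A : Fin n → H →L[ℂ] H}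
  {D : H →L[ℂ] H} {C : ℝ}

theorem hasSum_iterate_phi_defect_dilate (hm : 1 ≤ m) (hC : 0 ≤ C) (hA : RowBounded f A C)
    (hD : D ∈ f.cone m A) {r : ℝ} (hr : r ∈ Set.Ico (0 : ℝ) 1) :
    HasSum (fun k => (((k + (m - 1)).choose (m - 1) : ℕ) : ℂ) •
      (f.Phi (dilate r A))^[k] (f.defect (dilate r A) m D)) D := by
  have hr' : r ∈ Set.Icc (0 : ℝ) 1 := ⟨hr.1, hr.2.le⟩
  -- Only the order-one inequality at A itself is used here; dilation then supplies the factor r².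
  have h1 : f.Phi A D ≤ D := by
    have := hD.2 1 (Finset.mem_Icc.2 ⟨le_rfl, hm⟩)
    rw [PosRegular.defect_succ, PosRegular.defect_zero, sub_nonneg] at this
    exact this
  exact hasSum_iterate_phi_defect (hA.dilate hr') hC (sq_nonneg r)
    (pow_lt_one₀ hr.1 hr.2 two_ne_zero) hD.1
    ((phi_dilate_le hA hC hr' hD.1).trans (smul_le_smul_of_le (sq_nonneg r) h1)) hm

theorem exists_isBerezinKernel_dilate (hm : 1 ≤ m) (hC : 0 ≤ C) (hA : RowBounded f A C)
    (hD : D ∈ f.cone m A) {r : ℝ} (hr : r ∈ Set.Ico (0 : ℝ) 1)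
    (hR : 0 ≤ f.defect (dilate r A) m D) :
    IsBerezinKernel f m (dilate r A) (f.defect (dilate r A) m D)
        (berezinKernel f m (dilate r A) (f.defect (dilate r A) m D)) ∧
      tensorGram (berezinKernel f m (dilate r A) (f.defect (dilate r A) m D)) = D := by
  have h1 := hasSum_weight_conjForm (hA.dilate ⟨hr.1, hr.2.le⟩) hC hR
    (hasSum_iterate_phi_defect_dilate hm hC hA hD hr)
  have h2 := exists_isBerezinKernel hR h1
  have h3 : IsBerezinKernel f m (dilate r A) (f.defect (dilate r A) m D)
      (berezinKernel f m (dilate r A) (f.defect (dilate r A) m D)) := by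
    rw [berezinKernel, dif_pos h2]
    exact h2.choose_spec
  exact ⟨h3, h3.tensorGram_eq hR hD.1 h1⟩

theorem compatible_dilate (hm : 1 ≤ m) (hC : 0 ≤ C) (hA : RowBounded f A C)
    (hP : ∀ p ∈ P, IsHomogeneousPoly p) (hPA : ∀ p ∈ P, polyEval A p = 0)
    (hD : D ∈ f.cone m A) {r : ℝ} (hr : r ∈ Set.Ico (0 : ℝ) 1)
    (hR : 0 ≤ f.defect (dilate r A) m D) :
    Compatible f m P (dilate r A) (f.defect (dilate r A) m D) where
  sot := by
    refine ⟨f.Phi (dilate r A) 1, fun x => ?_⟩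
    have h1 := HasSum.tendsto_wordBall (hasSum_phi (hA.dilate ⟨hr.1, hr.2.le⟩) hC 1 x)
      (by simp [f.term_nil])
    refine h1.congr fun N => ?_
    rw [f.partialSum_eq, sum_apply]
  pos := hR
  bound := by
    -- The sum is D itself. The added 1 keeps the bound strictly positive when D = 0.
    refine ⟨D, SOTTendsto.wot fun x => ?_, ‖D‖ + 1, by positivity, ?_⟩
    · exact ((ContinuousLinearMap.apply ℂ H x).continuous.tendsto D).comp
        (hasSum_iterate_phi_defect_dilate hm hC hA hD hr).tendsto_sum_nat
    · have h1 := IsSelfAdjoint.le_algebraMap_norm_self (ha := hD.1.isSelfAdjoint)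
      refine h1.trans ?_
      have h2 : algebraMap ℝ (H →L[ℂ] H) ‖D‖ = (‖D‖ : ℂ) • (1 : H →L[ℂ] H) := by
        rw [Algebra.algebraMap_eq_smul_one]
        ext x
        simp
      rw [h2, Complex.ofReal_add, add_smul, Complex.ofReal_one, one_smul]
      exact le_add_of_nonneg_right zero_le_one
  annihilates p hp := polyEval_dilate (hP p hp) (hPA p hp) r

theorem exists_mem_CPMaps (hm : 1 ≤ m) (hC : 0 ≤ C) (hA : RowBounded f A C)
    (hP : ∀ p ∈ P, IsHomogeneousPoly p) (hPA : ∀ p ∈ P, polyEval A p = 0)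
    (hD : D ∈ f.cone m A) {δ : ℝ} (hδ : δ ∈ Set.Ioo (0 : ℝ) 1)
    (hR : ∀ r ∈ Set.Ioo δ 1, 0 ≤ f.defect (dilate r A) m D) :
    ∃ φ ∈ CPMaps f m P A, φ (opOne f m P) = D ∧ ∀ χ : OpSystem f m P,
      Tendsto (fun r : ℝ => berezinTransform f m P (dilate r A) (f.defect (dilate r A) m D)
        (χ : NSpace f m P →L[ℂ] NSpace f m P)) (𝓝[<] 1) (𝓝 (φ χ)) := by
  let Ψ : ℝ → (NSpace f m P →L[ℂ] NSpace f m P) →ₗ[ℂ] (H →L[ℂ] H) := fun r =>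
    tensorCompression (constrainedKernel f m P (dilate r A) (f.defect (dilate r A) m D))
  have hker : ∀ r ∈ Set.Ioo δ 1,
      tensorGram (constrainedKernel f m P (dilate r A) (f.defect (dilate r A) m D)) = D ∧
      ∀ i h, tensorId _ (star (BModel f m P i))
        (constrainedKernel f m P (dilate r A) (f.defect (dilate r A) m D) h) =
        constrainedKernel f m P (dilate r A) (f.defect (dilate r A) m D)
          (star (dilate r A i) h) := by
    intro r hr
    obtain ⟨h1, h2⟩ := exists_isBerezinKernel_dilate hm hC hA hD
      ⟨(hδ.1.trans hr.1).le, hr.2⟩ (hR r hr)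
    have h3 : ∀ p ∈ P, polyEval (dilate r A) p = 0 := fun p hp =>
      polyEval_dilate (hP p hp) (hPA p hp) r
    exact ⟨tensorGram_constrainedKernel h1 h3 h2,
      tensorId_star_BModel_constrainedKernel h1 h3⟩
  have hev : ∀ᶠ r : ℝ in 𝓝[<] 1, r ∈ Set.Ioo δ 1 := Ioo_mem_nhdsLT hδ.2
  refine exists_pairMap_of_tendsto (E := NSpace f m P) (B := BModel f m P) (Ψ := Ψ) (M := ‖D‖)
    ?_ ?_ ?_
  · filter_upwards [hev] with r hr χ
    exact norm_tensorCompression_le (hker r hr).1 χ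
  · intro r k T hT
    exact matrixPos_tensorCompression _ hT
  · intro α β
    -- On generators the transform depends on r only through this scalar factor, since the Gram
    -- operator is D for every r.
    have h1 : Tendsto (fun r : ℝ => ((r : ℂ) ^ α.length * (r : ℂ) ^ β.length) •
        (wordProd A α * D * star (wordProd A β))) (𝓝[<] 1)
        (𝓝 (wordProd A α * D * star (wordProd A β))) := by
      have h2 : Continuous fun r : ℝ => ((r : ℂ) ^ α.length * (r : ℂ) ^ β.length) •
          (wordProd A α * D * star (wordProd A β)) := by fun_prop
      simpa using (h2.tendsto 1).mono_left nhdsWithin_le_nhds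
    refine h1.congr' ?_
    filter_upwards [hev] with r hr
    refine Eq.trans ?_ (tensorCompression_wordPair (E := NSpace f m P) (hker r hr).1
      (hker r hr).2 α β).symm
    rw [star_wordProd_dilate, wordProd_dilate, smul_mul_assoc, smul_mul_smul_comm]

end Radial

end NCVariety

end

theorem mainTheorem6 {n m : ℕ} (hn : 1 ≤ n) (hm : 1 ≤ m)
    (f : NCVariety.PosRegular n) (hf : f.IsRadial m)
    (P : Set (FreeAlgebra ℂ (Fin n)))
    (hP : ∀ p ∈ P, NCVariety.IsHomogeneousPoly p)
    (hN : NCVariety.NSpace f m P ≠ ⊥)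
    {H : Type*} [NormedAddCommGroup H] [InnerProductSpace ℂ H] [CompleteSpace H]
    (A : Fin n → H →L[ℂ] H)
    (hA : NCVariety.SOTSummable f A)
    (hPA : ∀ p ∈ P, NCVariety.polyEval A p = 0) :
    Set.BijOn
      (fun φ : NCVariety.OpSystem f m P →ₗ[ℂ] (H →L[ℂ] H) => φ (NCVariety.opOne f m P))
      (NCVariety.CPMaps f m P A) (f.coneRad m A) ∧
    ∀ D ∈ f.coneRad m A,
      (∃ δ ∈ Set.Ioo (0 : ℝ) 1, ∀ r ∈ Set.Ioo δ 1,
        NCVariety.Compatible f m P (NCVariety.dilate r A)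
          (f.defect (NCVariety.dilate r A) m D) ∧
        NCVariety.IsBerezinKernel f m (NCVariety.dilate r A)
          (f.defect (NCVariety.dilate r A) m D)
          (NCVariety.berezinKernel f m (NCVariety.dilate r A)
            (f.defect (NCVariety.dilate r A) m D))) ∧
      ∀ φ ∈ NCVariety.CPMaps f m P A, φ (NCVariety.opOne f m P) = D →
        ∀ χ : NCVariety.OpSystem f m P,
          Tendsto
            (fun r : ℝ => NCVariety.berezinTransform f m P (NCVariety.dilate r A)
              (f.defect (NCVariety.dilate r A) m D)
              (χ : NCVariety.NSpace f m P →L[ℂ] NCVariety.NSpace f m P))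
            (𝓝[<] 1) (𝓝 (φ χ)) := by
  obtain ⟨T, hT⟩ := id hA
  have hrow := NCVariety.rowBounded_of_wotTendsto hT.wot
  have hC : 0 ≤ ‖T‖ := norm_nonneg T
  have hpos : ∀ D ∈ f.coneRad m A, ∃ δ ∈ Set.Ioo (0 : ℝ) 1, ∀ r ∈ Set.Ioo δ 1,
      0 ≤ f.defect (NCVariety.dilate r A) m D := by
    rintro D ⟨-, δ, hδ, h⟩
    exact ⟨δ, hδ, fun r hr => (h r ⟨hr.1, hr.2.le⟩).2 m (Finset.mem_Icc.2 ⟨hm, le_rfl⟩)⟩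
  have hex : ∀ D ∈ f.coneRad m A, ∃ φ ∈ NCVariety.CPMaps f m P A,
      φ (NCVariety.opOne f m P) = D ∧ ∀ χ : NCVariety.OpSystem f m P,
        Tendsto (fun r : ℝ => NCVariety.berezinTransform f m P (NCVariety.dilate r A)
          (f.defect (NCVariety.dilate r A) m D)
          (χ : NCVariety.NSpace f m P →L[ℂ] NCVariety.NSpace f m P)) (𝓝[<] 1) (𝓝 (φ χ)) := by
    intro D hD
    obtain ⟨δ, hδ, hR⟩ := hpos D hD
    exact NCVariety.exists_mem_CPMaps hm hC hrow hP hPA hD.1 hδ hR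
  refine ⟨⟨fun φ hφ => NCVariety.CPMaps.map_one_mem_coneRad hf hA hφ,
    fun φ hφ ψ hψ h => NCVariety.CPMaps.ext hφ hψ h,
    fun D hD => ?_⟩, fun D hD => ⟨?_, fun φ hφ hφD χ => ?_⟩⟩
  · obtain ⟨φ, hφ, h, -⟩ := hex D hD
    exact ⟨φ, hφ, h⟩
  · obtain ⟨δ, hδ, hR⟩ := hpos D hD
    refine ⟨δ, hδ, fun r hr => ?_⟩
    have hr' : r ∈ Set.Ico (0 : ℝ) 1 := ⟨(hδ.1.trans hr.1).le, hr.2⟩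
    exact ⟨NCVariety.compatible_dilate hm hC hrow hP hPA hD.1 hr' (hR r hr),
      (NCVariety.exists_isBerezinKernel_dilate hm hC hrow hD.1 hr' (hR r hr)).1⟩
  -- The limit formula is known for the constructed preimage; uniqueness transfers it to any
  -- preimage of D.
  · obtain ⟨ψ, hψ, h, hlim⟩ := hex D hD
    have h1 : φ = ψ := NCVariety.CPMaps.ext hφ hψ (hφD.trans h.symm)
    rw [h1]
    exact hlim χ
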